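/- Let $V(x,\cdot)$, $x\in\mathbb{Z}$, be i.i.d. real random variables on a probability space $(\Omega,\mathcal F,\mathbb P)$ such that $\mathbb P(V(0,\cdot)\ge 0)=1$, $\mathbb P(V(0,\cdot)>0)>0$ and $\mathbb E[V(0,\cdot)]<\infty$. For fixed $\omega$ let $P^\omega$ (with expectation $E^\omega$) be the law of the killed random walk $(S_n)_{n\ge 0}$ on $\mathbb Z\cup\{\dagger\}$ started at $0$: from a site $x\in\mathbb Z$ it moves to $\dagger$ with probability $1-e^{-V(x,\omega)}$ and to each of $x+1$, $x-1$ with probability $\tfrac12 e^{-V(x,\omega)}$, and $\dagger$ is absorbing. Put $\tau_x=\inf\{n>0: S_n=x\}\in\mathbb N\cup\{\infty\}$ and, for $y\in\mathbb{N}$, $Q^\omega_y(\cdot)=P^\omega(\,\cdot\mid\tau_y<\infty)$. Let $E$ denote the expectation for the simple symmetric random walk on $\mathbb Z$ started at $0$. Then there is a deterministic $v^{\mathrm{que}}\in(0,\infty)$ such that $\mathbb P$-almost surely $$\lim_{y\to\infty}\frac{E_{Q^\omega_y}(\tau_y)}{y}=\frac1{v^{\mathrm{que}}},\qquad\text{and}\qquad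 \frac{1}{v^{\mathrm{que}}}=\mathbb E\big[E^\omega(\tau_1\mid\tau_1<\infty)\big]<\infty .$$ Moreover, for every $\lambda\ge 0$ the quenched Lyapunov exponent $$\alpha_{\lambda+V}(1)=-\lim_{y\to\infty}\frac1y\log E\Big(\mathbf 1_{\{\tau_y<\infty\}}\,e^{-\sum_{n=0}^{\tau_y-1}(\lambda+V(S_n,\omega))}\Big)$$ exists $\mathbb P$-almost surely as a deterministic finite limit, the function $\lambda\mapsto\alpha_{\lambda+V}(1)$ on $[0,\infty)$ has a right derivative at $0$, and $$\frac1{v^{\mathrm{que}}}=\frac{d}{d\lambda}\,\alpha_{\lambda+V}(1)\Big|_{\lambda=0+}.$$ -/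

import Mathlib

open MeasureTheory ProbabilityTheory Filter Topology
open scoped ENNReal NNReal

noncomputable section

namespace CrossingSpeed

/-- The law on path space `ℕ → S` (Ionescu-Tulcea) of the time-homogeneous Markov chain with
transition kernel `K` started at `x`. -/
def chainLaw {S : Type} [MeasurableSpace S] (K : Kernel S S) [IsMarkovKernel K] (x : S) :
    Measure (ℕ → S) :=
  Kernel.trajMeasure (X := fun _ : ℕ => S) (Measure.dirac x)
    (fun n => K.comap (fun h : (i : Finset.Iic n) → S => h ⟨n, Finset.mem_Iic.2 le_rfl⟩)
      (measurable_pi_apply _))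

/-- `τ_x(s) = inf {n > 0 : s n = x}`, with value `⊤` if `x` is not hit at a positive time. -/
def hitTime {S : Type} (x : S) (s : ℕ → S) : ℕ∞ :=
  ⨅ (n : ℕ) (_ : 0 < n ∧ s n = x), (n : ℕ∞)

/-- Transition kernel of the simple symmetric random walk on `ℤ`. -/
def srwKernel : Kernel ℤ ℤ :=
  Kernel.ofFunOfCountable fun x =>
    (2⁻¹ : ℝ≥0∞) • Measure.dirac (x + 1) + (2⁻¹ : ℝ≥0∞) • Measure.dirac (x - 1)

instance : IsMarkovKernel srwKernel := by
  refine ⟨fun x => ⟨?_⟩⟩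
  simp [srwKernel, Kernel.ofFunOfCountable, ENNReal.inv_two_add_inv_two]

/-- The law `P` of the simple symmetric random walk started at `0`. -/
def srwLaw : Measure (ℕ → ℤ) := chainLaw srwKernel 0

/-- The state space `ℤ ∪ {†}` of the killed walk. -/
inductive KilledState : Type
  | site : ℤ → KilledState
  | dead : KilledState

instance : MeasurableSpace KilledState := ⊤

instance : DiscreteMeasurableSpace KilledState := ⟨fun _ => trivial⟩

instance : Countable KilledState :=
  Function.Injective.countable
    (f := fun s : KilledState => match s with
      | .site x => some x
      | .dead => none)
    (by rintro (x | _) (y | _) h <;> simp_all)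

/-- One step of the killed walk in the potential `v`: from a site `x` the walk dies with
probability `1 - exp (-v x)` and moves to each of `x + 1`, `x - 1` with probability
`exp (-v x) / 2`; the state `dead` is absorbing. -/
def killedStep (v : ℤ → ℝ≥0) : KilledState → Measure KilledState
  | .site x =>
      ENNReal.ofReal (1 - Real.exp (-(v x : ℝ))) • Measure.dirac .dead +
        (ENNReal.ofReal (Real.exp (-(v x : ℝ)) / 2) • Measure.dirac (.site (x + 1)) +
          ENNReal.ofReal (Real.exp (-(v x : ℝ)) / 2) • Measure.dirac (.site (x - 1)))
  | .dead => Measure.dirac .dead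

/-- Transition kernel of the killed walk. -/
def killedKernel (v : ℤ → ℝ≥0) : Kernel KilledState KilledState :=
  Kernel.ofFunOfCountable (killedStep v)

instance (v : ℤ → ℝ≥0) : IsMarkovKernel (killedKernel v) := by
  refine ⟨fun s => ⟨?_⟩⟩
  cases s with
  | dead => simp [killedKernel, Kernel.ofFunOfCountable, killedStep]
  | site x =>
    have h1 : Real.exp (-(v x : ℝ)) ≤ 1 := Real.exp_le_one_iff.2 (by simp)
    have h0 := Real.exp_pos (-(v x : ℝ))
    simp only [killedKernel, Kernel.ofFunOfCountable, killedStep, Kernel.coe_mk,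
      Measure.add_apply, Measure.smul_apply, measure_univ, smul_eq_mul, mul_one]
    rw [← ENNReal.ofReal_add (by positivity) (by positivity),
      ← ENNReal.ofReal_add (by linarith) (by positivity)]
    simp

/-- The quenched law of the killed walk in the potential `v`, started at the site `0`. -/
def killedLaw (v : ℤ → ℝ≥0) : Measure (ℕ → KilledState) :=
  chainLaw (killedKernel v) (.site 0)

/-- The quenched path measure: the killed walk conditioned on `τ_y < ∞`. -/
def quenchedPathMeasure (v : ℤ → ℝ≥0) (y : ℤ) : Measure (ℕ → KilledState) :=
  cond (killedLaw v) {s | hitTime (.site y) s < ⊤}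

/-- `E(τ_y | τ_y < ∞)` for the killed walk in the potential `v`, with values in `[0, ∞]`. -/
def meanCrossingTime (v : ℤ → ℝ≥0) (y : ℤ) : ℝ≥0∞ :=
  ∫⁻ s, (hitTime (.site y) s : ℝ≥0∞) ∂(quenchedPathMeasure v y)

/-- The partition function `E (1_{τ_y < ∞} exp (-∑_{n < τ_y} u (S_n)))` of the simple random
walk in the potential `u`. -/
def partitionFunction (u : ℤ → ℝ) (y : ℤ) : ℝ :=
  ∫ s, Set.indicator {s : ℕ → ℤ | hitTime y s < ⊤}
    (fun s => Real.exp (-∑ n ∈ Finset.range (hitTime y s).toNat, u (s n))) s ∂srwLaw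

section Random

variable {Ω : Type*} [MeasurableSpace Ω]

/-- The environment seen by the killed walk. Since the potential is almost surely
nonnegative, taking positive parts changes it only on a null set. -/
def environment (V : ℤ → Ω → ℝ) (ω : Ω) : ℤ → ℝ≥0 := fun x => (V x ω).toNNReal

/-- `v` is the (deterministic, positive, finite) quenched speed of the potential `V`: almost
surely, the conditional mean of `τ_y`, divided by `y`, tends to `1 / v` as `y → ∞`. -/
def IsQuenchedSpeed (μ : Measure Ω) (V : ℤ → Ω → ℝ) (v : ℝ) : Prop :=
  0 < v ∧ ∀ᵐ ω ∂μ, Tendsto (fun y : ℕ => meanCrossingTime (environment V ω) y / (y : ℝ≥0∞))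
    atTop (𝓝 (ENNReal.ofReal (1 / v)))

/-- `a` is the (deterministic, finite) quenched Lyapunov exponent of the potential `V`:
almost surely, `-(1/y) log E (1_{τ_y < ∞} exp (-∑_{n < τ_y} V (S_n)))` tends to `a`. -/
def IsQuenchedLyapunovExponent (μ : Measure Ω) (V : ℤ → Ω → ℝ) (a : ℝ) : Prop :=
  ∀ᵐ ω ∂μ, Tendsto
    (fun y : ℕ => -((1 / (y : ℝ)) * Real.log (partitionFunction (fun x => V x ω) y)))
    atTop (𝓝 a)

end Random

end CrossingSpeed

end

noncomputable section

namespace CrossingSpeed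

/-! ### Hitting times of Markov chains -/

section HitTime

variable {S : Type}

/-! The walk is nearest-neighbour, so it cannot reach `y` from `0` without visiting `1, ..., y - 1`.
Cutting a path at these first visits makes the total weight `crossWeight` of the crossings
multiplicative, and makes `E(τ_y | τ_y < ∞)` a sum of one-step means. Both `-log crossWeight` and
the conditional mean are thus Birkhoff sums, under the shift of the environment, of the one-site
functionals `freeEnergy` and `stepTime`. The ergodic theorem for an i.i.d. environment turns the two
quotients by `y` into expectations, once integrability is known.

For `freeEnergy` integrability is easy: stepping right at once gives the bound `λ + V(0) + log 2`.
For `stepTime` it is the heart of the proof (`stepMean_le_two_add`, `lintegral_stepTime_lt_top`). If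
`m x` is the mean time from `x` to `x + 1`, a first-step analysis gives `m x ≤ 2 + exp (-V x) * m (x
- 1)`. The two factors on the right are independent, since `m (x - 1)` sees only sites below `x`. By
stationarity `E m ≤ 2 + θ E m` with `θ = E exp (-V) < 1`, so `E m ≤ 2 / (1 - θ)`. To subtract
legitimately, the recursion is run with truncated times, and the truncation is removed by monotone
convergence.

For the derivative, adding `λ` to the potential multiplies the weight of a path of length `n` by
`exp (-λ n)`. So `freeEnergy` is minus the logarithm of a Laplace transform, with right derivative
`stepTime` at `0`. Jensen's inequality bounds the difference quotients by `stepTime`, and dominated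
convergence differentiates under the expectation. -/

lemma hitTime_eq_coe_iff {y : S} {s : ℕ → S} (n : ℕ) :
    hitTime y s = n ↔ (0 < n ∧ s n = y) ∧ ∀ i < n, ¬ (0 < i ∧ s i = y) := by
  have hex (h : ∃ m, 0 < m ∧ s m = y) :
      ∃ m, (0 < m ∧ s m = y) ∧ (∀ i < m, ¬ (0 < i ∧ s i = y)) ∧ hitTime y s = m := by
    classical
    refine ⟨Nat.find h, Nat.find_spec h, fun i hi => Nat.find_min h hi, ?_⟩
    refine le_antisymm (iInf₂_le (Nat.find h) (Nat.find_spec h)) (le_iInf₂ fun m hm => ?_)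
    exact_mod_cast Nat.find_min' h hm
  constructor
  · intro h
    have : ∃ m, 0 < m ∧ s m = y := by
      by_contra! hne
      have : hitTime y s = ⊤ := by
        simp only [hitTime, iInf_eq_top]
        exact fun i hi => absurd hi.2 (hne i hi.1)
      rw [this] at h
      exact absurd h.symm (ENat.natCast_ne_top n)
    obtain ⟨m, hm, hmin, he⟩ := hex this
    obtain rfl : n = m := by exact_mod_cast h.symm.trans he
    exact ⟨hm, hmin⟩
  · rintro ⟨hn, hmin⟩
    obtain ⟨m, hm, hmin', he⟩ := hex ⟨n, hn⟩
    obtain rfl : m = n := by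
      rcases lt_trichotomy m n with h | h | h
      · exact absurd hm (hmin m h)
      · exact h
      · exact absurd hn (hmin' n h)
    exact he

/-- `hitTime` ignores time `0`, whereas first visits in the path sums include it. The two
conventions agree when the start differs from the target. -/
lemma hitTime_eq_coe_iff_of_ne {y : S} {s : ℕ → S} (h0 : s 0 ≠ y) (n : ℕ) :
    hitTime y s = n ↔ s n = y ∧ ∀ i < n, s i ≠ y := by
  have hpos (i : ℕ) : (0 < i ∧ s i = y) ↔ s i = y :=
    ⟨And.right, fun h => ⟨Nat.pos_of_ne_zero (by rintro rfl; exact h0 h), h⟩⟩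
  simp only [hitTime_eq_coe_iff, hpos, ne_eq]

lemma measurable_hitTime [MeasurableSpace S] [DiscreteMeasurableSpace S] (y : S) : Measurable (hitTime (S := S) y) := by
  have hset (n : ℕ) : MeasurableSet {s : ℕ → S | 0 < n ∧ s n = y} :=
    (MeasurableSet.const _).inter
      (show MeasurableSet ((fun s : ℕ → S => s n) ⁻¹' {y}) from
        measurable_pi_apply n (measurableSet_singleton y))
  refine ENat.measurable_iff.2 fun n => ?_
  have : hitTime y ⁻¹' {(n : ℕ∞)} = {s : ℕ → S | 0 < n ∧ s n = y} ∩
      ⋂ i : Fin n, {s : ℕ → S | 0 < (i : ℕ) ∧ s i = y}ᶜ := by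
    ext s
    simp only [Set.mem_preimage, Set.mem_singleton_iff, hitTime_eq_coe_iff, Set.mem_inter_iff,
      Set.mem_iInter, Fin.forall_iff, Set.mem_compl_iff, Set.mem_ofPred_eq]
  rw [this]
  exact (hset n).inter (MeasurableSet.iInter fun i => (hset i).compl)

end HitTime

section Chain

variable {S : Type} [MeasurableSpace S] (K : Kernel S S) [IsMarkovKernel K] (x : S)

instance : IsProbabilityMeasure (chainLaw K x) := by
  unfold chainLaw; infer_instance

/-- The Markov property of the chain at a deterministic time. -/
lemma lintegral_chainLaw_succ (n : ℕ) {φ : ((i : Finset.Iic n) → S) → ℝ≥0∞} (hφ : Measurable φ)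
    {f : S → ℝ≥0∞} (hf : Measurable f) :
    ∫⁻ s, φ (Preorder.frestrictLe (π := fun _ : ℕ => S) n s) * f (s (n + 1)) ∂chainLaw K x =
      ∫⁻ s, φ (Preorder.frestrictLe (π := fun _ : ℕ => S) n s) * ∫⁻ z, f z ∂K (s n)
        ∂chainLaw K x := by
  have key := Kernel.map_frestrictLe_trajMeasure_compProd_eq_map_trajMeasure
    (X := fun _ : ℕ => S) (μ₀ := Measure.dirac x)
    (κ := fun n => K.comap (fun h : (i : Finset.Iic n) → S => h ⟨n, Finset.mem_Iic.2 le_rfl⟩)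
      (measurable_pi_apply _)) (a := n)
  change (chainLaw K x).map _ ⊗ₘ _ = (chainLaw K x).map _ at key
  have hmeas : Measurable fun q : ((i : Finset.Iic n) → S) × S => φ q.1 * f q.2 := by fun_prop
  have h1 := congrArg (fun m => ∫⁻ q, φ q.1 * f q.2 ∂m) key
  rw [Measure.lintegral_compProd hmeas, lintegral_map (by fun_prop) (by fun_prop),
    lintegral_map hmeas (by fun_prop)] at h1
  rw [← h1]
  refine lintegral_congr fun s => ?_
  exact lintegral_const_mul (μ := K (s n)) (φ (Preorder.frestrictLe n s)) hf

lemma chainLaw_zero [MeasurableSingletonClass S] : ∀ᵐ s ∂chainLaw K x, s 0 = x := by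
  have h : (chainLaw K x).map (Preorder.frestrictLe (π := fun _ : ℕ => S) 0) =
      (Measure.dirac x).map (MeasurableEquiv.piUnique (fun _ : Finset.Iic 0 => S)).symm := by
    rw [chainLaw, Kernel.trajMeasure, Measure.map_comp _ _ (by fun_prop),
      Kernel.traj_map_frestrictLe, Kernel.partialTraj_self]
    exact Measure.id_comp
  have h2 : ∀ᵐ q ∂(chainLaw K x).map (Preorder.frestrictLe (π := fun _ : ℕ => S) 0),
      q ⟨0, Finset.mem_Iic.2 le_rfl⟩ = x := by
    rw [h, Measure.map_dirac' (MeasurableEquiv.measurable _)]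
    have hm : MeasurableSet ((fun q : (i : Finset.Iic 0) → S =>
        q ⟨0, Finset.mem_Iic.2 le_rfl⟩) ⁻¹' {x}) :=
      measurable_pi_apply (⟨0, Finset.mem_Iic.2 le_rfl⟩ : Finset.Iic 0) (measurableSet_singleton x)
    exact (ae_dirac_iff hm).2 rfl
  exact ae_of_ae_map (by fun_prop) h2

/-- `hitWeight K g y n x` is the expectation, for the chain with kernel `K` started at `x`, of
the product of `g` along the path up to the first visit to `y` (time `0` included), on the event
that this visit occurs at time `n`. -/
def hitWeight {S : Type} [MeasurableSpace S] (K : Kernel S S) (g : S → ℝ≥0∞) (y : S) :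
    ℕ → S → ℝ≥0∞
  | 0 => Set.indicator {y} 1
  | n + 1 => Set.indicator {y}ᶜ fun x => g x * ∫⁻ z, hitWeight K g y n z ∂K x

variable [Countable S] [DiscreteMeasurableSpace S]

/-- The Markov property unrolls the recursion of `hitWeight` one step at a time. Thus `k`
interpolates between the recursion at the starting point and, for `n = 0`, an integral over paths,
in which the indicators of `{y}ᶜ` discard earlier visits to `y`. -/
lemma lintegral_prod_mul_hitWeight (g : S → ℝ≥0∞) (y : S) (k n : ℕ) :
    ∫⁻ s, (∏ i ∈ Finset.range k, Set.indicator {y}ᶜ g (s i)) * hitWeight K g y n (s k)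
      ∂chainLaw K x = hitWeight K g y (k + n) x := by
  induction k generalizing n with
  | zero =>
    have : (fun s : ℕ → S => (∏ i ∈ Finset.range 0, Set.indicator {y}ᶜ g (s i)) *
        hitWeight K g y n (s 0)) =ᵐ[chainLaw K x] fun _ => hitWeight K g y n x := by
      filter_upwards [chainLaw_zero K x] with s hs
      simp [hs]
    rw [lintegral_congr_ae this]
    simp
  | succ k ih =>
    let φ : ((i : Finset.Iic k) → S) → ℝ≥0∞ := fun q =>
      ∏ i ∈ (Finset.range (k + 1)).attach,
        Set.indicator {y}ᶜ g (q ⟨i, Finset.mem_Iic.2 (Nat.lt_succ_iff.1 (Finset.mem_range.1 i.2))⟩)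
    have hφ : Measurable φ :=
      Finset.measurable_fun_prod _ fun i _ =>
        (measurable_of_countable (Set.indicator {y}ᶜ g)).comp (measurable_pi_apply _)
    have hφs (s : ℕ → S) : φ (Preorder.frestrictLe (π := fun _ : ℕ => S) k s) =
        ∏ i ∈ Finset.range (k + 1), Set.indicator {y}ᶜ g (s i) :=
      Finset.prod_attach (Finset.range (k + 1)) fun i => Set.indicator {y}ᶜ g (s i)
    have := lintegral_chainLaw_succ K x k hφ (measurable_of_countable (hitWeight K g y n))
    simp only [hφs] at this
    rw [this, show k + 1 + n = k + (n + 1) by ring, ← ih]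
    refine lintegral_congr fun s => ?_
    rw [Finset.prod_range_succ, mul_assoc]
    congr 1
    by_cases h : s k = y <;> simp [hitWeight, h]

/-- The law of the hitting time, weighted by the product of `g` along the path. -/
lemma setLIntegral_hitTime_eq {x y : S} (hxy : x ≠ y) (g : S → ℝ≥0∞) (n : ℕ) :
    ∫⁻ s in {s | hitTime y s = n}, ∏ i ∈ Finset.range n, g (s i) ∂chainLaw K x =
      hitWeight K g y n x := by
  have hm : MeasurableSet {s : ℕ → S | hitTime y s = n} :=
    measurable_hitTime y (measurableSet_singleton _)
  rw [← lintegral_indicator hm, ← add_zero n, ← lintegral_prod_mul_hitWeight K x g y n 0, add_zero]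
  refine lintegral_congr_ae ?_
  filter_upwards [chainLaw_zero K x] with s hs
  have hiff := hitTime_eq_coe_iff_of_ne (y := y) (s := s) (by rwa [hs]) n
  by_cases h : hitTime y s = n
  · obtain ⟨h1, h2⟩ := hiff.1 h
    rw [Set.indicator_of_mem (by exact h), hitWeight, h1,
      Set.indicator_of_mem (Set.mem_singleton y), Pi.one_apply, mul_one]
    refine Finset.prod_congr rfl fun i hi => ?_
    rw [Set.indicator_of_mem]
    exact h2 i (Finset.mem_range.1 hi)
  · rw [Set.indicator_of_notMem (by exact h)]
    by_cases h1 : s n = y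
    · have : ∃ i < n, s i = y := by
        by_contra! h2
        exact h (hiff.2 ⟨h1, h2⟩)
      obtain ⟨i, hi, hiy⟩ := this
      rw [Finset.prod_eq_zero (Finset.mem_range.2 hi) (by simp [hiy]), zero_mul]
    · simp [hitWeight, h1]

end Chain

/-! ### Path measures in terms of weights of paths -/

/-- The total weight of the nearest-neighbour paths from `x` whose first visit to `y` occurs at
time `n`, where a step from the site `z` has weight `w z / 2`. -/
def pathWeight (w : ℤ → ℝ≥0∞) (y : ℤ) : ℕ → ℤ → ℝ≥0∞
  | 0, x => if x = y then 1 else 0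
  | n + 1, x =>
    if x = y then 0 else w x * (2⁻¹ * (pathWeight w y n (x + 1) + pathWeight w y n (x - 1)))

lemma lintegral_srwKernel (f : ℤ → ℝ≥0∞) (x : ℤ) :
    ∫⁻ z, f z ∂srwKernel x = 2⁻¹ * (f (x + 1) + f (x - 1)) := by
  simp [srwKernel, Kernel.ofFunOfCountable, mul_add]

lemma hitWeight_srwKernel (w : ℤ → ℝ≥0∞) (y : ℤ) (n : ℕ) (x : ℤ) :
    hitWeight srwKernel w y n x = pathWeight w y n x := by
  induction n generalizing x with
  | zero => simp [hitWeight, pathWeight, Set.indicator_apply]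
  | succ n ih =>
    by_cases h : x = y
    · simp [hitWeight, pathWeight, h]
    · simp [hitWeight, pathWeight, h, lintegral_srwKernel, ih]

/-- The weight of a step from the site `x` in the potential `u`. -/
def expWeight (u : ℤ → ℝ) (x : ℤ) : ℝ≥0∞ := ENNReal.ofReal (Real.exp (-u x))

lemma lintegral_killedKernel_dead (v : ℤ → ℝ≥0) (f : KilledState → ℝ≥0∞) :
    ∫⁻ z, f z ∂killedKernel v .dead = f .dead := by
  simp [killedKernel, Kernel.ofFunOfCountable, killedStep]

lemma lintegral_killedKernel_site (v : ℤ → ℝ≥0) (f : KilledState → ℝ≥0∞) (hf : f .dead = 0)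
    (x : ℤ) : ∫⁻ z, f z ∂killedKernel v (.site x) =
      expWeight (fun z => v z) x * (2⁻¹ * (f (.site (x + 1)) + f (.site (x - 1)))) := by
  have h2 : ENNReal.ofReal (Real.exp (-(v x : ℝ)) / 2) =
      ENNReal.ofReal (Real.exp (-(v x : ℝ))) * 2⁻¹ := by
    rw [div_eq_mul_inv, ENNReal.ofReal_mul (Real.exp_pos _).le,
      ENNReal.ofReal_inv_of_pos two_pos, ENNReal.ofReal_ofNat]
  simp [killedKernel, Kernel.ofFunOfCountable, killedStep, hf, h2, expWeight, mul_add, mul_assoc]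

lemma hitWeight_killedKernel_dead (v : ℤ → ℝ≥0) (y : ℤ) (n : ℕ) :
    hitWeight (killedKernel v) 1 (.site y) n .dead = 0 := by
  induction n with
  | zero => simp [hitWeight]
  | succ n ih => simp [hitWeight, lintegral_killedKernel_dead, ih]

/-- Feynman–Kac: surviving each step has probability `exp (-v)`, and a dead path never reaches a
site. Hence killing, and weighting the simple random walk by the potential, give the same path sums.
-/
lemma hitWeight_killedKernel_site (v : ℤ → ℝ≥0) (y : ℤ) (n : ℕ) (x : ℤ) :
    hitWeight (killedKernel v) 1 (.site y) n (.site x) =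
      pathWeight (expWeight fun z => v z) y n x := by
  induction n generalizing x with
  | zero => by_cases h : x = y <;> simp [hitWeight, pathWeight, h]
  | succ n ih =>
    by_cases h : x = y
    · simp [hitWeight, pathWeight, h]
    · simp [hitWeight, pathWeight, h, ih, hitWeight_killedKernel_dead,
        lintegral_killedKernel_site]

/-- The total weight of the paths from `x` to the first visit to `y`. -/
def crossWeight (w : ℤ → ℝ≥0∞) (y x : ℤ) : ℝ≥0∞ := ∑' n, pathWeight w y n x

/-- The total weight of the paths from `x` to the first visit to `y`, counted with their
length. -/
def crossTime (w : ℤ → ℝ≥0∞) (y x : ℤ) : ℝ≥0∞ := ∑' n : ℕ, n * pathWeight w y n x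

section Finite

variable {S : Type}

lemma setOf_hitTime_lt_top (y : S) : {s : ℕ → S | hitTime y s < ⊤} =
    ⋃ n : ℕ, {s : ℕ → S | hitTime y s = n} := by
  ext s
  simp only [Set.mem_ofPred_eq, Set.mem_iUnion, lt_top_iff_ne_top, ENat.ne_top_iff_exists, eq_comm]

lemma pairwise_disjoint_hitTime (y : S) :
    Pairwise (Function.onFun Disjoint fun n : ℕ => {s : ℕ → S | hitTime y s = n}) := by
  intro m n hmn
  refine Set.disjoint_left.2 fun s hm hn => hmn ?_
  have : (m : ℕ∞) = n := hm.symm.trans hn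
  exact_mod_cast this

variable [MeasurableSpace S] [DiscreteMeasurableSpace S]

lemma measurableSet_hitTime_eq (y : S) (n : ℕ∞) : MeasurableSet {s : ℕ → S | hitTime y s = n} :=
  measurable_hitTime y (measurableSet_singleton _)

lemma setLIntegral_hitTime_lt_top (μ : Measure (ℕ → S)) (y : S) (f : (ℕ → S) → ℝ≥0∞) :
    ∫⁻ s in {s | hitTime y s < ⊤}, f s ∂μ =
      ∑' n : ℕ, ∫⁻ s in {s | hitTime y s = n}, f s ∂μ := by
  rw [setOf_hitTime_lt_top, lintegral_iUnion (fun n : ℕ => measurableSet_hitTime_eq y n)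
    (pairwise_disjoint_hitTime y)]

end Finite

lemma killedLaw_hitTime_eq (v : ℤ → ℝ≥0) {y : ℤ} (hy : y ≠ 0) (n : ℕ) :
    killedLaw v {s | hitTime (.site y) s = n} =
      pathWeight (expWeight fun z => v z) y n 0 := by
  have h := setLIntegral_hitTime_eq (killedKernel v) (x := .site 0) (y := .site y)
    (by simpa using hy.symm) 1 n
  simpa [hitWeight_killedKernel_site, killedLaw] using h

lemma meanCrossingTime_eq (v : ℤ → ℝ≥0) {y : ℤ} (hy : y ≠ 0) :
    meanCrossingTime v y =
      crossTime (expWeight fun z => v z) y 0 / crossWeight (expWeight fun z => v z) y 0 := by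
  have hP : killedLaw v {s | hitTime (.site y) s < ⊤} =
      crossWeight (expWeight fun z => v z) y 0 := by
    have := setLIntegral_hitTime_lt_top (killedLaw v) (.site y) 1
    simpa [killedLaw_hitTime_eq v hy, crossWeight] using this
  rw [meanCrossingTime, quenchedPathMeasure, ProbabilityTheory.cond, lintegral_smul_measure, hP,
    setLIntegral_hitTime_lt_top, smul_eq_mul, mul_comm, ← div_eq_mul_inv, crossTime]
  congr 2
  ext n
  have : ∫⁻ s in {s | hitTime (.site y) s = n}, (hitTime (.site y) s : ℝ≥0∞) ∂killedLaw v =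
      ∫⁻ s in {s | hitTime (.site y) s = n}, (n : ℝ≥0∞) ∂killedLaw v :=
    setLIntegral_congr_fun (measurableSet_hitTime_eq _ _) fun s hs => by
      rw [show hitTime (.site y) s = n from hs]; simp
  rw [this, setLIntegral_const, killedLaw_hitTime_eq v hy]

lemma partitionFunction_eq (u : ℤ → ℝ) {y : ℤ} (hy : y ≠ 0) :
    partitionFunction u y = (crossWeight (expWeight u) y 0).toReal := by
  have hset : MeasurableSet {s : ℕ → ℤ | hitTime y s < ⊤} :=
    measurable_hitTime y (MeasurableSet.of_discrete (s := Set.Iio ⊤))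
  have hmeas : Measurable fun s : ℕ → ℤ =>
      Real.exp (-∑ n ∈ Finset.range (hitTime y s).toNat, u (s n)) := by
    have h : Measurable fun q : (ℕ → ℤ) × ℕ => Real.exp (-∑ n ∈ Finset.range q.2, u (q.1 n)) :=
      measurable_from_prod_countable_left fun n =>
        (Finset.measurable_fun_sum (Finset.range n) fun i _ =>
          (measurable_of_countable u).comp (measurable_pi_apply i)).neg.exp
    exact h.comp (measurable_id.prodMk ((measurable_of_countable ENat.toNat).comp
      (measurable_hitTime y)))
  rw [partitionFunction, integral_indicator hset, integral_eq_lintegral_of_nonneg_ae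
    (Eventually.of_forall fun s => (Real.exp_pos _).le) hmeas.aestronglyMeasurable,
    setLIntegral_hitTime_lt_top, crossWeight]
  congr 2
  ext n
  rw [← hitWeight_srwKernel, ← setLIntegral_hitTime_eq srwKernel hy.symm, srwLaw]
  refine setLIntegral_congr_fun (measurableSet_hitTime_eq _ _) fun s hs => ?_
  simp only [show hitTime y s = n from hs, ENat.toNat_natCast, expWeight]
  rw [← ENNReal.ofReal_prod_of_nonneg (fun _ _ => (Real.exp_pos _).le), ← Real.exp_sum,
    Finset.sum_neg_distrib]

/-! ### Decomposition of paths -/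

section Weights

variable (w : ℤ → ℝ≥0∞)

lemma pathWeight_self (y : ℤ) (n : ℕ) : pathWeight w y n y = if n = 0 then 1 else 0 := by
  cases n <;> simp [pathWeight]

lemma pathWeight_succ {x y : ℤ} (h : x ≠ y) (n : ℕ) : pathWeight w y (n + 1) x =
    w x * (2⁻¹ * (pathWeight w y n (x + 1) + pathWeight w y n (x - 1))) := by
  simp [pathWeight, h]

/-- A path from `x` to `z` passes through every `y` between `x` and `z`. -/
lemma pathWeight_eq_sum_antidiagonal {x y z : ℤ} (hxy : x ≤ y) (hyz : y ≤ z) (n : ℕ) :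
    pathWeight w z n x =
      ∑ q ∈ Finset.HasAntidiagonal.antidiagonal n, pathWeight w y q.1 x * pathWeight w z q.2 y := by
  induction n generalizing x with
  | zero =>
    rcases hxy.eq_or_lt with rfl | hlt
    · simp [pathWeight]
    · simp [pathWeight, hlt.ne, (hlt.trans_le hyz).ne]
  | succ n ih =>
    rw [Finset.Nat.sum_antidiagonal_succ]
    rcases hxy.eq_or_lt with rfl | hlt
    · simp [pathWeight_self]
    · have h0 : pathWeight w y 0 x = 0 := by simp [pathWeight, hlt.ne]
      rw [h0, zero_mul, zero_add, pathWeight_succ w (hlt.trans_le hyz).ne,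
        ih (x := x + 1) (by lia), ih (x := x - 1) (by lia), ← Finset.sum_add_distrib,
        Finset.mul_sum, Finset.mul_sum]
      refine Finset.sum_congr rfl fun q _ => ?_
      rw [pathWeight_succ w hlt.ne]
      ring

lemma tsum_antidiagonal (f : ℕ → ℕ → ℝ≥0∞) :
    ∑' n, ∑ q ∈ Finset.HasAntidiagonal.antidiagonal n, f q.1 q.2 = ∑' k, ∑' l, f k l := by
  rw [← ENNReal.tsum_prod (f := f), ← Finset.HasAntidiagonal.sigmaAntidiagonalEquivProd.tsum_eq,
    ENNReal.tsum_sigma']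
  refine tsum_congr fun n => ?_
  rw [tsum_fintype, ← Finset.sum_coe_sort]
  rfl

/-- The total weight of the paths from `x` to the first visit to `y`, where a path of length `n`
is counted with multiplicity `c n`. -/
def crossSum (c : ℕ → ℝ≥0∞) (y x : ℤ) : ℝ≥0∞ := ∑' n, c n * pathWeight w y n x

lemma crossTime_eq_crossSum : crossTime w = crossSum w (fun n => n) := rfl

lemma crossWeight_self (y : ℤ) : crossWeight w y y = 1 := by
  simp [crossWeight, pathWeight_self]

lemma crossSum_self (c : ℕ → ℝ≥0∞) (y : ℤ) : crossSum w c y y = c 0 := by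
  simp [crossSum, pathWeight_self]

/-- Summing the convolution identity for `pathWeight` over all lengths factorizes it. -/
lemma crossWeight_mul {x y z : ℤ} (hxy : x ≤ y) (hyz : y ≤ z) :
    crossWeight w z x = crossWeight w y x * crossWeight w z y := by
  simp_rw [crossWeight, pathWeight_eq_sum_antidiagonal w hxy hyz]
  rw [tsum_antidiagonal fun k l => pathWeight w y k x * pathWeight w z l y]
  simp_rw [ENNReal.tsum_mul_left, ENNReal.tsum_mul_right]

lemma tsum_tsum_add_mul (c : ℕ → ℝ≥0∞) (x y z : ℤ) :
    ∑' k, ∑' l, (c k + c l) * (pathWeight w y k x * pathWeight w z l y) =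
      crossSum w c y x * crossWeight w z y + crossWeight w y x * crossSum w c z y := by
  have (k l : ℕ) : (c k + c l) * (pathWeight w y k x * pathWeight w z l y) =
      c k * pathWeight w y k x * pathWeight w z l y +
        pathWeight w y k x * (c l * pathWeight w z l y) := by ring
  simp_rw [this, ENNReal.tsum_add, ENNReal.tsum_mul_left, ENNReal.tsum_mul_right]
  rfl

lemma crossSum_eq_tsum_tsum (c : ℕ → ℝ≥0∞) {x y z : ℤ} (hxy : x ≤ y) (hyz : y ≤ z) :
    crossSum w c z x = ∑' k, ∑' l, c (k + l) * (pathWeight w y k x * pathWeight w z l y) := by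
  simp_rw [crossSum, pathWeight_eq_sum_antidiagonal w hxy hyz]
  rw [← tsum_antidiagonal fun k l => c (k + l) * (pathWeight w y k x * pathWeight w z l y)]
  refine tsum_congr fun n => ?_
  rw [Finset.mul_sum]
  refine Finset.sum_congr rfl fun q hq => ?_
  rw [Finset.HasAntidiagonal.mem_antidiagonal.1 hq]

/-- Subadditivity is all that truncated lengths retain; for the true length the same computation is
an equality, the Leibniz rule `crossTime_add`. -/
lemma crossSum_le_add {c : ℕ → ℝ≥0∞} (hc : ∀ k l, c (k + l) ≤ c k + c l) {x y z : ℤ}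
    (hxy : x ≤ y) (hyz : y ≤ z) : crossSum w c z x ≤
      crossSum w c y x * crossWeight w z y + crossWeight w y x * crossSum w c z y := by
  rw [crossSum_eq_tsum_tsum w c hxy hyz, ← tsum_tsum_add_mul]
  gcongr
  exact hc _ _

lemma crossTime_add {x y z : ℤ} (hxy : x ≤ y) (hyz : y ≤ z) : crossTime w z x =
    crossTime w y x * crossWeight w z y + crossWeight w y x * crossTime w z y := by
  simp_rw [crossTime_eq_crossSum]
  rw [crossSum_eq_tsum_tsum w _ hxy hyz, ← tsum_tsum_add_mul]
  simp

lemma crossWeight_succ {x y : ℤ} (h : x ≠ y) : crossWeight w y x =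
    w x * (2⁻¹ * (crossWeight w y (x + 1) + crossWeight w y (x - 1))) := by
  rw [crossWeight, tsum_eq_zero_add' ENNReal.summable]
  simp [pathWeight, h, crossWeight, ENNReal.tsum_mul_left, ENNReal.tsum_add]

lemma crossSum_le_succ {c : ℕ → ℝ≥0∞} (hc : ∀ n, c (n + 1) ≤ 1 + c n) {x y : ℤ} (h : x ≠ y) :
    crossSum w c y x ≤ w x * (2⁻¹ * ((crossWeight w y (x + 1) + crossWeight w y (x - 1)) +
      (crossSum w c y (x + 1) + crossSum w c y (x - 1)))) := by
  rw [crossSum, tsum_eq_zero_add' ENNReal.summable]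
  have h0 : pathWeight w y 0 x = 0 := by simp [pathWeight, h]
  rw [h0, mul_zero, zero_add]
  simp_rw [crossSum, crossWeight, ← ENNReal.tsum_add, ← ENNReal.tsum_mul_left]
  refine ENNReal.tsum_le_tsum fun n => ?_
  rw [pathWeight_succ w h]
  calc _ ≤ (1 + c n) * (w x * (2⁻¹ * (pathWeight w y n (x + 1) + pathWeight w y n (x - 1)))) := by
        gcongr; exact hc n
    _ = _ := by ring

/-! ### Sub-probability weights and the one-step mean -/

variable {w}

lemma sum_pathWeight_le_one (hw : ∀ x, w x ≤ 1) (y : ℤ) (N : ℕ) (x : ℤ) :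
    ∑ n ∈ Finset.range N, pathWeight w y n x ≤ 1 := by
  induction N generalizing x with
  | zero => simp
  | succ N ih =>
    rw [Finset.sum_range_succ']
    by_cases h : x = y
    · simp [pathWeight, h]
    · simp only [pathWeight_succ w h, ← Finset.mul_sum, Finset.sum_add_distrib]
      simp only [pathWeight, h, if_false, add_zero]
      calc _ ≤ (1 : ℝ≥0∞) * (2⁻¹ * (1 + 1)) := by
            gcongr
            · exact hw x
            · exact ih _
            · exact ih _
        _ = 1 := by rw [one_add_one_eq_two, one_mul, ENNReal.inv_mul_cancel (by simp) (by simp)]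

lemma crossWeight_le_one (hw : ∀ x, w x ≤ 1) (y x : ℤ) : crossWeight w y x ≤ 1 :=
  ENNReal.tsum_le_of_sum_range_le fun N => sum_pathWeight_le_one hw y N x

lemma crossWeight_ne_top (hw : ∀ x, w x ≤ 1) (y x : ℤ) : crossWeight w y x ≠ ⊤ :=
  ((crossWeight_le_one hw y x).trans_lt ENNReal.one_lt_top).ne

/-- The first step either reaches `x + 1`, or goes to `x - 1`, from where the path must come back to
`x` and start afresh. -/
lemma crossWeight_step (w : ℤ → ℝ≥0∞) (x : ℤ) : crossWeight w (x + 1) x =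
    w x * (2⁻¹ * (1 + crossWeight w x (x - 1) * crossWeight w (x + 1) x)) := by
  rw [← crossWeight_mul w (x := x - 1) (y := x) (z := x + 1) (by simp) (by simp),
    crossWeight_succ w (by simp), crossWeight_self]

lemma le_crossWeight_step (x : ℤ) : w x * 2⁻¹ ≤ crossWeight w (x + 1) x := by
  rw [crossWeight_step]
  gcongr
  calc (2⁻¹ : ℝ≥0∞) = 2⁻¹ * 1 := (mul_one _).symm
    _ ≤ _ := by gcongr; exact le_self_add

lemma crossWeight_pos (h0 : ∀ x, w x ≠ 0) {x y : ℤ} (hxy : x ≤ y) : crossWeight w y x ≠ 0 := by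
  induction y, hxy using Int.leInduction with
  | base => simp [crossWeight_self]
  | succ y hy ih =>
    rw [crossWeight_mul w hy (by simp)]
    refine mul_ne_zero ih fun h => ?_
    have := (le_crossWeight_step (w := w) y).trans_eq h
    simp [h0] at this

/-- The mean number of steps, under the normalized path weights, before the first visit to
`x + 1` of a path from `x`, where a path of length `n` counts as `c n`. -/
def stepMean (w : ℤ → ℝ≥0∞) (c : ℕ → ℝ≥0∞) (x : ℤ) : ℝ≥0∞ :=
  crossSum w c (x + 1) x / crossWeight w (x + 1) x

lemma crossWeight_eq_prod (w : ℤ → ℝ≥0∞) (y : ℕ) :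
    crossWeight w y 0 = ∏ x ∈ Finset.range y, crossWeight w (x + 1) x := by
  induction y with
  | zero => simp [crossWeight_self]
  | succ y ih =>
    rw [Finset.prod_range_succ, ← ih]
    exact_mod_cast crossWeight_mul w (x := 0) (y := y) (z := y + 1) (by positivity) (by simp)

/-- Dividing the Leibniz rule `crossTime_add` by the product formula `crossWeight_mul` gives
additivity of the normalized mean. -/
lemma crossTime_div_crossWeight (hw : ∀ x, w x ≤ 1) (h0 : ∀ x, w x ≠ 0) (y : ℕ) :
    crossTime w y 0 / crossWeight w y 0 =
      ∑ x ∈ Finset.range y, stepMean w (fun n => n) x := by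
  induction y with
  | zero => simp [crossTime_eq_crossSum, crossSum_self]
  | succ y ih =>
    have hy : (0 : ℤ) ≤ y := by positivity
    have hy' : (y : ℤ) ≤ y + 1 := by simp
    have h1 := crossWeight_pos h0 hy
    have h2 := crossWeight_ne_top hw y 0
    have h3 := crossWeight_pos h0 hy'
    have h4 := crossWeight_ne_top hw (y + 1) y
    rw [Finset.sum_range_succ, ← ih, stepMean]
    push_cast
    rw [crossTime_add w hy hy', crossWeight_mul w hy hy', ENNReal.add_div,
      ENNReal.mul_div_mul_right _ _ h3 h4, ENNReal.mul_div_mul_left _ _ h1 h2]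
    rfl

lemma stepMean_le_of_le {c : ℕ → ℝ≥0∞} {C : ℝ≥0∞} (hc : ∀ n, c n ≤ C) (x : ℤ) :
    stepMean w c x ≤ C := by
  refine ENNReal.div_le_of_le_mul ?_
  rw [crossSum, crossWeight, ← ENNReal.tsum_mul_left]
  gcongr
  exact hc _

/-- Write `m`, `m'` for the means at `x`, `x - 1`. A path from `x` makes one step; if this goes
left, it needs a crossing from `x - 1` to `x` and another one from `x` to `x + 1`. After division by
the crossing weight this reads `m ≤ 1 + m / 2 + w x * m' / 2`, and the finite `m` can be cancelled.
-/
lemma stepMean_le_two_add (hw : ∀ x, w x ≤ 1) (h0 : ∀ x, w x ≠ 0) {c : ℕ → ℝ≥0∞} (hc0 : c 0 = 0)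
    (hc : ∀ n, c (n + 1) ≤ 1 + c n) (hc' : ∀ k l, c (k + l) ≤ c k + c l) {x : ℤ}
    (hfin : stepMean w c x ≠ ⊤) :
    stepMean w c x ≤ 2 + w x * stepMean w c (x - 1) := by
  have hp0 := crossWeight_pos h0 (x := x) (y := x + 1) (by simp)
  have hp1 := crossWeight_le_one hw (x + 1) x
  have hp := crossWeight_ne_top hw (x + 1) x
  have hq0 := crossWeight_pos h0 (x := x - 1) (y := x) (by simp)
  have hq1 := crossWeight_le_one hw x (x - 1)
  have hq := crossWeight_ne_top hw x (x - 1)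
  have hT : crossSum w c (x + 1) x = stepMean w c x * crossWeight w (x + 1) x :=
    (ENNReal.div_mul_cancel hp0 hp).symm
  have hT' : crossSum w c x (x - 1) = stepMean w c (x - 1) * crossWeight w x (x - 1) := by
    have := (ENNReal.div_mul_cancel (b := crossSum w c x (x - 1)) hq0 hq).symm
    simpa [stepMean] using this
  have h1 := crossSum_le_succ w hc (x := x) (y := x + 1) (by simp)
  have h2 := crossSum_le_add w hc' (x := x - 1) (y := x) (z := x + 1) (by simp) (by simp)
  have h3 := crossWeight_step w x
  have h4 := crossWeight_mul w (x := x - 1) (y := x) (z := x + 1) (by simp) (by simp)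
  rw [crossSum_self, hc0, crossWeight_self, h4, zero_add] at h1
  rw [hT, hT'] at h2
  have h5 : stepMean w c x * crossWeight w (x + 1) x ≤
      (1 + 2⁻¹ * stepMean w c x + w x * (2⁻¹ * stepMean w c (x - 1))) *
        crossWeight w (x + 1) x := by
    rw [← hT]
    calc crossSum w c (x + 1) x ≤ _ := h1
      _ = w x * (2⁻¹ * (1 + crossWeight w x (x - 1) * crossWeight w (x + 1) x)) +
          w x * (2⁻¹ * crossSum w c (x + 1) (x - 1)) := by ring
      _ = crossWeight w (x + 1) x + w x * (2⁻¹ * crossSum w c (x + 1) (x - 1)) := by rw [← h3]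
      _ ≤ crossWeight w (x + 1) x + w x * (2⁻¹ *
          (stepMean w c (x - 1) * crossWeight w x (x - 1) * crossWeight w (x + 1) x +
            crossWeight w x (x - 1) * (stepMean w c x * crossWeight w (x + 1) x))) := by gcongr
      _ = crossWeight w (x + 1) x + w x * (2⁻¹ *
          (stepMean w c (x - 1) * crossWeight w x (x - 1))) * crossWeight w (x + 1) x +
            w x * (2⁻¹ * (crossWeight w x (x - 1) * stepMean w c x)) *
              crossWeight w (x + 1) x := by ring
      -- The factor `w x` is dropped only next to the mean at `x`. Next to the mean at `x - 1` it
      -- must survive, since its expectation below `1` is what closes the recursion.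
      _ ≤ crossWeight w (x + 1) x + w x * (2⁻¹ *
          (stepMean w c (x - 1) * 1)) * crossWeight w (x + 1) x +
            1 * (2⁻¹ * (1 * stepMean w c x)) * crossWeight w (x + 1) x := by
          gcongr; exact hw x
      _ = _ := by ring
  have h6 := (ENNReal.mul_le_mul_iff_left hp0 hp).1 h5
  have h7 : stepMean w c x + stepMean w c x ≤
      (2 + w x * stepMean w c (x - 1)) + stepMean w c x := by
    calc stepMean w c x + stepMean w c x = 2 * stepMean w c x := (two_mul _).symm
      _ ≤ 2 * (1 + 2⁻¹ * stepMean w c x + w x * (2⁻¹ * stepMean w c (x - 1))) := by gcongr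
      _ = 2 + (2 * 2⁻¹) * (w x * stepMean w c (x - 1)) + (2 * 2⁻¹) * stepMean w c x := by ring
      _ = _ := by rw [ENNReal.mul_inv_cancel (by simp) (by simp), one_mul, one_mul]
  exact (ENNReal.add_le_add_iff_right hfin).1 h7

lemma one_le_stepMean (hw : ∀ x, w x ≤ 1) (h0 : ∀ x, w x ≠ 0) (x : ℤ) :
    1 ≤ stepMean w (fun n => n) x := by
  rw [stepMean, ENNReal.le_div_iff_mul_le (.inl (crossWeight_pos h0 (by simp)))
    (.inl (crossWeight_ne_top hw _ _)), one_mul, crossWeight, crossSum]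
  refine ENNReal.tsum_le_tsum fun n => ?_
  cases n with
  | zero => simp [pathWeight]
  | succ n =>
    calc _ = 1 * pathWeight w (x + 1) (n + 1) x := (one_mul _).symm
      _ ≤ _ := by gcongr; simp

/-! ### Scaling, translation and measurability of path weights -/

lemma pathWeight_const_mul (a : ℝ≥0∞) (w : ℤ → ℝ≥0∞) (y : ℤ) (n : ℕ) (x : ℤ) :
    pathWeight (fun z => a * w z) y n x = a ^ n * pathWeight w y n x := by
  induction n generalizing x with
  | zero => simp [pathWeight]
  | succ n ih =>
    by_cases h : x = y
    · simp [pathWeight, h]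
    · rw [pathWeight_succ _ h, pathWeight_succ _ h, ih, ih]
      ring

lemma pathWeight_shift (w : ℤ → ℝ≥0∞) (k y : ℤ) (n : ℕ) (x : ℤ) :
    pathWeight (fun z => w (z + k)) y n x = pathWeight w (y + k) n (x + k) := by
  induction n generalizing x with
  | zero => simp [pathWeight]
  | succ n ih =>
    by_cases h : x = y
    · simp [pathWeight, h]
    · rw [pathWeight_succ _ h, pathWeight_succ _ (by simpa using h), ih, ih]
      ring_nf

/-- A path from the left of `y` stops at `y`, so only weights strictly below `y` matter. The
hypothesis is confined to these sites because independence is later read off from this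
measurability. -/
lemma measurable_pathWeight {E : Type*} {mE : MeasurableSpace E} {w : E → ℤ → ℝ≥0∞} {y : ℤ}
    (hw : ∀ z < y, Measurable fun e => w e z) (n : ℕ) {x : ℤ} (hxy : x ≤ y) :
    Measurable fun e => pathWeight (w e) y n x := by
  induction n generalizing x with
  | zero => exact measurable_const
  | succ n ih =>
    rcases hxy.eq_or_lt with rfl | h
    · simp [pathWeight]
    · simp_rw [fun e => pathWeight_succ (w e) h.ne n]
      have h1 := ih (x := x + 1) (by lia)
      have h2 := ih (x := x - 1) (by lia)
      exact (hw x h).mul ((h1.add h2).const_mul _)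

lemma measurable_crossWeight {E : Type*} {mE : MeasurableSpace E} {w : E → ℤ → ℝ≥0∞} {y : ℤ}
    (hw : ∀ z < y, Measurable fun e => w e z) {x : ℤ} (hxy : x ≤ y) :
    Measurable fun e => crossWeight (w e) y x :=
  Measurable.tsum fun n => measurable_pathWeight hw n hxy

lemma measurable_stepMean {E : Type*} {mE : MeasurableSpace E} {w : E → ℤ → ℝ≥0∞} {x : ℤ}
    (hw : ∀ z ≤ x, Measurable fun e => w e z) (c : ℕ → ℝ≥0∞) :
    Measurable fun e => stepMean (w e) c x :=
  (Measurable.tsum fun n => (measurable_pathWeight (fun z hz => hw z (by lia)) n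
    (by simp)).const_mul (c n)).div (measurable_crossWeight (fun z hz => hw z (by lia)) (by simp))

end Weights

/-! ### The maximal ergodic theorem -/

section Maximal

variable {X : Type*} {T : X → X} {f : X → ℝ}

/-- The maximum of the Birkhoff sums of `f` of length at most `n`. -/
def maxBirkhoffSum (T : X → X) (f : X → ℝ) : ℕ → X → ℝ
  | 0, _ => 0
  | n + 1, x => max 0 (f x + maxBirkhoffSum T f n (T x))

lemma maxBirkhoffSum_nonneg (n : ℕ) (x : X) : 0 ≤ maxBirkhoffSum T f n x := by
  cases n
  · exact le_rfl
  · exact le_max_left _ _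

lemma maxBirkhoffSum_le_succ (n : ℕ) (x : X) :
    maxBirkhoffSum T f n x ≤ maxBirkhoffSum T f (n + 1) x := by
  induction n generalizing x with
  | zero => exact maxBirkhoffSum_nonneg _ _
  | succ n ih => exact max_le_max le_rfl (by simpa using ih (T x))

lemma birkhoffSum_le_maxBirkhoffSum (n : ℕ) (x : X) :
    birkhoffSum T f n x ≤ maxBirkhoffSum T f n x := by
  induction n generalizing x with
  | zero => simp [maxBirkhoffSum]
  | succ n ih =>
    rw [birkhoffSum_succ']
    exact le_max_of_le_right (by simpa using ih (T x))

/-- Where the maximum is positive it is attained by a nonempty sum, so it equals `f x` plus a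
maximum over shorter sums at `T x`. Elsewhere it vanishes, and the one at `T x` is nonnegative. -/
lemma maxBirkhoffSum_sub_le (n : ℕ) (x : X) :
    maxBirkhoffSum T f n x - maxBirkhoffSum T f n (T x) ≤
      Set.indicator {x | 0 < maxBirkhoffSum T f n x} f x := by
  by_cases h : 0 < maxBirkhoffSum T f n x
  · rw [Set.indicator_of_mem (by exact h)]
    cases n with
    | zero => exact absurd h (lt_irrefl _)
    | succ n =>
      have h1 := maxBirkhoffSum_le_succ (T := T) (f := f) n (T x)
      have h2 : maxBirkhoffSum T f (n + 1) x = f x + maxBirkhoffSum T f n (T x) := by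
        rcases max_choice 0 (f x + maxBirkhoffSum T f n (T x)) with h3 | h3
        · exact absurd h (by rw [maxBirkhoffSum, h3]; exact lt_irrefl _)
        · exact h3
      linarith
  · rw [Set.indicator_of_notMem (by exact h)]
    have := maxBirkhoffSum_nonneg (T := T) (f := f) n (T x)
    linarith [not_lt.1 h]

variable [MeasurableSpace X] {μ : Measure X}

lemma measurable_maxBirkhoffSum (hT : Measurable T) (hf : Measurable f) (n : ℕ) :
    Measurable (maxBirkhoffSum T f n) := by
  induction n with
  | zero => exact measurable_const
  | succ n ih => exact measurable_const.max (hf.add (ih.comp hT))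

lemma integrable_maxBirkhoffSum (hT : MeasurePreserving T μ μ) (hf : Integrable f μ) (n : ℕ) :
    Integrable (maxBirkhoffSum T f n) μ := by
  induction n with
  | zero => exact integrable_zero _ _ _
  | succ n ih => exact (integrable_zero _ _ _).sup (hf.add (hT.integrable_comp_of_integrable ih))

/-- The **maximal ergodic theorem**. -/
lemma setIntegral_maxBirkhoffSum_nonneg (hT : MeasurePreserving T μ μ) (hf : Integrable f μ)
    (hfm : Measurable f) (n : ℕ) : 0 ≤ ∫ x in {x | 0 < maxBirkhoffSum T f n x}, f x ∂μ := by
  have hM := integrable_maxBirkhoffSum hT hf n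
  have hMT : Integrable (fun x => maxBirkhoffSum T f n (T x)) μ :=
    hT.integrable_comp_of_integrable hM
  have hset : MeasurableSet {x | 0 < maxBirkhoffSum T f n x} :=
    measurableSet_lt measurable_const (measurable_maxBirkhoffSum hT.measurable hfm n)
  have h1 : ∫ x, maxBirkhoffSum T f n (T x) ∂μ = ∫ x, maxBirkhoffSum T f n x ∂μ := by
    have := integral_map (μ := μ) hT.measurable.aemeasurable
      (f := maxBirkhoffSum T f n)
      (measurable_maxBirkhoffSum hT.measurable hfm n).aestronglyMeasurable
    rw [hT.map_eq] at this
    exact this.symm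
  rw [← integral_indicator hset]
  calc (0 : ℝ) = ∫ x, (maxBirkhoffSum T f n x - maxBirkhoffSum T f n (T x)) ∂μ := by
        rw [integral_sub hM hMT, h1, sub_self]
    _ ≤ _ := integral_mono (hM.sub hMT) (hf.indicator hset) (maxBirkhoffSum_sub_le n)

/-- Weak-type inequality: the maximal ergodic theorem is applied to `|f| - t`, whose maximal sums
are positive on an increasing sequence of sets exhausting the event. -/
lemma measure_exists_birkhoffSum_le [IsProbabilityMeasure μ] (hT : MeasurePreserving T μ μ)
    (hf : Integrable f μ) (hfm : Measurable f) {t : ℝ} (ht : 0 < t) :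
    μ {x | ∃ n : ℕ, n * t < birkhoffSum T (fun x => |f x|) n x} ≤
      ENNReal.ofReal ((∫ x, |f x| ∂μ) / t) := by
  set g : X → ℝ := fun x => |f x| - t with hg
  have hgi : Integrable g μ := hf.abs.sub (integrable_const t)
  have hgm : Measurable g := by fun_prop
  have hsub : {x | ∃ n : ℕ, n * t < birkhoffSum T (fun x => |f x|) n x} ⊆
      ⋃ n : ℕ, {x | 0 < maxBirkhoffSum T g n x} := by
    rintro x ⟨n, hn⟩
    refine Set.mem_iUnion.2 ⟨n, lt_of_lt_of_le ?_ (birkhoffSum_le_maxBirkhoffSum n x)⟩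
    have : birkhoffSum T g n x = birkhoffSum T (fun x => |f x|) n x - n * t := by
      simp [birkhoffSum, hg]
    linarith
  refine (measure_mono hsub).trans ?_
  have hmono : Monotone fun n : ℕ => {x | 0 < maxBirkhoffSum T g n x} :=
    monotone_nat_of_le_succ fun n x hx => lt_of_lt_of_le hx (maxBirkhoffSum_le_succ n x)
  rw [hmono.measure_iUnion]
  refine iSup_le fun n => ?_
  have hset : MeasurableSet {x | 0 < maxBirkhoffSum T g n x} :=
    measurableSet_lt measurable_const (measurable_maxBirkhoffSum hT.measurable hgm n)
  have h1 := setIntegral_maxBirkhoffSum_nonneg hT hgi hgm n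
  rw [hg, integral_sub hf.abs.integrableOn (integrable_const t), setIntegral_const, ← hg] at h1
  have h2 : ∫ x in {x | 0 < maxBirkhoffSum T g n x}, |f x| ∂μ ≤ ∫ x, |f x| ∂μ :=
    setIntegral_le_integral hf.abs (Eventually.of_forall fun x => abs_nonneg _)
  have h3 : μ.real {x | 0 < maxBirkhoffSum T g n x} ≤ (∫ x, |f x| ∂μ) / t := by
    rw [le_div_iff₀ ht]
    simp only [smul_eq_mul] at h1
    linarith
  rw [← ofReal_measureReal]
  exact ENNReal.ofReal_le_ofReal h3

/-- The set of integrable functions whose Birkhoff averages converge almost everywhere to their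
integral is closed for the `L¹` distance. -/
lemma ae_tendsto_birkhoffSum_div_of_approx [IsProbabilityMeasure μ] (hT : MeasurePreserving T μ μ)
    (hf : Integrable f μ) (hfm : Measurable f)
    (happ : ∀ ε > 0, ∃ g : X → ℝ, Measurable g ∧ Integrable g μ ∧ ∫ x, |f x - g x| ∂μ ≤ ε ∧
      ∀ᵐ x ∂μ, Tendsto (fun n : ℕ => birkhoffSum T g n x / n) atTop (𝓝 (∫ x, g x ∂μ))) :
    ∀ᵐ x ∂μ, Tendsto (fun n : ℕ => birkhoffSum T f n x / n) atTop (𝓝 (∫ x, f x ∂μ)) := by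
  have key (δ : ℝ) (hδ : 0 < δ) : ∀ᵐ x ∂μ, ∀ᶠ n : ℕ in atTop,
      |birkhoffSum T f n x / n - ∫ x, f x ∂μ| < 3 * δ := by
    rw [ae_iff]
    refine le_antisymm (ENNReal.le_of_forall_pos_le_add fun ε hε _ => ?_) zero_le
    rw [zero_add]
    -- The bound `δ` controls the difference of the integrals; the bound `ε * δ` makes the
    -- exceptional set of the maximal inequality have measure at most `ε`. The third `δ` is the
    -- convergence error of `g`.
    obtain ⟨g, hgm, hgi, hfg, hlim⟩ := happ (min δ (ε * δ)) (by positivity)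
    have hmax := measure_exists_birkhoffSum_le hT (hf.sub hgi) (hfm.sub hgm) hδ
    have hsub : {x | ¬ ∀ᶠ n : ℕ in atTop, |birkhoffSum T f n x / n - ∫ x, f x ∂μ| < 3 * δ} ⊆
        {x | ∃ n : ℕ, n * δ < birkhoffSum T (fun x => |(f - g) x|) n x} ∪
        {x | ¬ Tendsto (fun n : ℕ => birkhoffSum T g n x / n) atTop (𝓝 (∫ x, g x ∂μ))} := by
      intro x hx
      by_contra hcon
      simp only [Set.mem_union, Set.mem_ofPred_eq, not_or, not_not, not_exists, not_lt] at hcon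
      refine hx ?_
      filter_upwards [Metric.tendsto_nhds.1 hcon.2 δ hδ, eventually_gt_atTop 0] with n hn hn0
      have hn0' : (0 : ℝ) < n := by exact_mod_cast hn0
      have h1 : |birkhoffSum T f n x / n - birkhoffSum T g n x / n| ≤ δ := by
        rw [← sub_div, abs_div, abs_of_pos hn0', div_le_iff₀ hn0', mul_comm]
        refine le_trans ?_ (hcon.1 n)
        simp only [birkhoffSum, ← Finset.sum_sub_distrib]
        exact Finset.abs_sum_le_sum_abs _ _
      have h2 : |(∫ x, g x ∂μ) - ∫ x, f x ∂μ| ≤ δ := by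
        rw [abs_sub_comm, ← integral_sub hf hgi]
        exact (abs_integral_le_integral_abs).trans (hfg.trans (min_le_left _ _))
      rw [Real.dist_eq] at hn
      have h3 := abs_sub_lt_iff.1 hn
      have h4 := abs_sub_le_iff.1 h1
      have h5 := abs_sub_le_iff.1 h2
      rw [abs_sub_lt_iff]
      constructor <;> linarith
    calc _ ≤ _ := measure_mono hsub
      _ ≤ _ := measure_union_le _ _
      _ ≤ ENNReal.ofReal ((∫ x, |(f - g) x| ∂μ) / δ) + 0 := by
        gcongr
        exact (ae_iff.1 hlim).le
      _ ≤ ε := by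
        rw [add_zero, ← ENNReal.ofReal_coe_nnreal]
        refine ENNReal.ofReal_le_ofReal ?_
        rw [div_le_iff₀ hδ]
        exact hfg.trans (min_le_right _ _)
  have hall : ∀ᵐ x ∂μ, ∀ k : ℕ, ∀ᶠ n : ℕ in atTop,
      |birkhoffSum T f n x / n - ∫ x, f x ∂μ| < 3 * (1 / ((k : ℝ) + 1)) :=
    ae_all_iff.2 fun k => key _ (by positivity)
  filter_upwards [hall] with x hx
  refine Metric.tendsto_nhds.2 fun ε hε => ?_
  obtain ⟨k, hk⟩ := exists_nat_one_div_lt (show (0 : ℝ) < ε / 3 by positivity)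
  filter_upwards [hx k] with n hn
  rw [Real.dist_eq]
  linarith

end Maximal

/-! ### Averages along residue classes -/

/-- There are `(n + (L - 1 - r)) / L` indices below `n` congruent to `r` modulo `L`. Passing from
`n` to `n + 1` adds a term to the class of `n % L` alone. -/
lemma sum_range_eq_sum_residues (a : ℕ → ℝ) {L : ℕ} (hL : 0 < L) (n : ℕ) :
    ∑ k ∈ Finset.range n, a k =
      ∑ r ∈ Finset.range L, ∑ j ∈ Finset.range ((n + (L - 1 - r)) / L), a (r + L * j) := by
  induction n with
  | zero =>
    symm
    refine Finset.sum_eq_zero fun r hr => ?_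
    rw [Nat.div_eq_of_lt (by lia)]
    simp
  | succ n ih =>
    rw [Finset.sum_range_succ, ih]
    have hmod : n % L < L := Nat.mod_lt _ hL
    have hdm := Nat.div_add_mod n L
    rw [← Finset.sum_erase_add _ _ (Finset.mem_range.2 hmod),
      ← Finset.sum_erase_add (Finset.range L) _ (Finset.mem_range.2 hmod), add_assoc]
    congr 1
    · refine Finset.sum_congr rfl fun r hr => ?_
      have hr1 := Finset.ne_of_mem_erase hr
      have hr2 := Finset.mem_range.1 (Finset.mem_of_mem_erase hr)
      have : (n + 1 + (L - 1 - r)) / L = (n + (L - 1 - r)) / L := by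
        rw [show n + 1 + (L - 1 - r) = n + (L - 1 - r) + 1 by ring, Nat.succ_div,
          if_neg, add_zero]
        rintro ⟨q, hq⟩
        apply hr1
        have h1 : n + L = r + L * q := by lia
        have h2 : (n + L) % L = (r + L * q) % L := by rw [h1]
        rw [Nat.add_mod_right, Nat.add_mul_mod_self_left, Nat.mod_eq_of_lt hr2] at h2
        exact h2.symm
      rw [this]
    · have h1 : (n + (L - 1 - n % L)) / L = n / L := by
        rw [show n + (L - 1 - n % L) = L * (n / L) + (L - 1) by lia, Nat.mul_add_div hL,
          Nat.div_eq_of_lt (a := L - 1) (by lia), add_zero]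
      have h2 : (n + 1 + (L - 1 - n % L)) / L = n / L + 1 := by
        rw [show n + 1 + (L - 1 - n % L) = L * (n / L) + L by lia, Nat.mul_add_div hL,
          Nat.div_self hL]
      rw [h1, h2, Finset.sum_range_succ, show n % L + L * (n / L) = n by lia]

lemma tendsto_add_div_div_natCast {L : ℕ} (hL : 0 < L) (b : ℕ) :
    Tendsto (fun n : ℕ => (((n + b) / L : ℕ) : ℝ) / n) atTop (𝓝 (1 / L)) := by
  have hL' : (0 : ℝ) < L := by exact_mod_cast hL
  have h1 : Tendsto (fun n : ℕ => (1 / L : ℝ) - 1 / n) atTop (𝓝 (1 / L - 0)) :=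
    tendsto_const_nhds.sub tendsto_one_div_atTop_nhds_zero_nat
  have h2 : Tendsto (fun n : ℕ => (1 / L : ℝ) + (b / L : ℝ) * (1 / n)) atTop
      (𝓝 (1 / L + b / L * 0)) :=
    tendsto_const_nhds.add (tendsto_one_div_atTop_nhds_zero_nat.const_mul _)
  rw [sub_zero] at h1
  rw [mul_zero, add_zero] at h2
  refine tendsto_of_tendsto_of_tendsto_of_le_of_le' h1 h2 ?_ ?_
  · filter_upwards [eventually_gt_atTop 0] with n hn
    have hn' : (0 : ℝ) < n := by exact_mod_cast hn
    have h3 : n < L * ((n + b) / L + 1) := by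
      have := Nat.lt_mul_div_succ (n + b) hL
      lia
    have h4 : (n : ℝ) < L * (((n + b) / L : ℕ) + 1) := by exact_mod_cast h3
    rw [le_div_iff₀ hn', sub_mul, one_div_mul_cancel hn'.ne', one_div_mul_eq_div,
      sub_le_iff_le_add, div_le_iff₀ hL']
    linarith
  · filter_upwards [eventually_gt_atTop 0] with n hn
    have hn' : (0 : ℝ) < n := by exact_mod_cast hn
    have h3 : (((n + b) / L : ℕ) : ℝ) ≤ ((n + b : ℕ) : ℝ) / L := Nat.cast_div_le
    rw [div_le_iff₀ hn']
    refine h3.trans (le_of_eq ?_)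
    push_cast
    field_simp

lemma tendsto_sum_div_of_residues {a : ℕ → ℝ} {c : ℝ} {L : ℕ} (hL : 0 < L)
    (h : ∀ r, Tendsto (fun q : ℕ => (∑ j ∈ Finset.range q, a (r + L * j)) / q) atTop (𝓝 c)) :
    Tendsto (fun n : ℕ => (∑ k ∈ Finset.range n, a k) / n) atTop (𝓝 c) := by
  have hL' : (0 : ℝ) < L := by exact_mod_cast hL
  have h1 (r : ℕ) : Tendsto (fun n : ℕ =>
      (∑ j ∈ Finset.range ((n + (L - 1 - r)) / L), a (r + L * j)) / n) atTop
      (𝓝 (c * (1 / L))) := by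
    have hq : Tendsto (fun n : ℕ => (n + (L - 1 - r)) / L) atTop atTop :=
      (Nat.tendsto_div_const_atTop hL.ne').comp (tendsto_add_atTop_nat _)
    refine (((h r).comp hq).mul (tendsto_add_div_div_natCast hL (L - 1 - r))).congr' ?_
    filter_upwards [hq.eventually_gt_atTop 0] with n hn
    have : (((n + (L - 1 - r)) / L : ℕ) : ℝ) ≠ 0 := by exact_mod_cast hn.ne'
    simp only [Function.comp]
    field_simp
  have h2 := tendsto_finsetSum (Finset.range L) fun r _ => h1 r
  simp only [Finset.sum_const, Finset.card_range, nsmul_eq_mul] at h2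
  rw [show (L : ℝ) * (c * (1 / L)) = c by field_simp] at h2
  refine h2.congr fun n => ?_
  rw [sum_range_eq_sum_residues a hL, Finset.sum_div]

/-! ### The ergodic theorem for i.i.d. sequences -/

section Shift

variable {𝓧 : Type*}

/-- The shift of two-sided sequences. -/
def shift (e : ℤ → 𝓧) : ℤ → 𝓧 := fun x => e (x + 1)

lemma shift_iterate (k : ℕ) (e : ℤ → 𝓧) : shift^[k] e = fun x => e (x + k) := by
  induction k with
  | zero => simp
  | succ k ih =>
    rw [Function.iterate_succ_apply', ih]
    funext x
    simp only [shift]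
    push_cast
    ring_nf

variable [MeasurableSpace 𝓧]

lemma measurable_shift : Measurable (shift (𝓧 := 𝓧)) :=
  measurable_pi_lambda _ fun _ => measurable_pi_apply _

variable (𝓧) in
/-- The σ-algebra generated by the coordinates with index in `I`. -/
@[reducible] def coordSigma (I : Set ℤ) : MeasurableSpace (ℤ → 𝓧) :=
  ⨆ i ∈ I, MeasurableSpace.comap (fun e : ℤ → 𝓧 => e i) inferInstance

lemma measurable_coord {I : Set ℤ} {i : ℤ} (hi : i ∈ I) :
    Measurable[coordSigma 𝓧 I] fun e : ℤ → 𝓧 => e i :=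
  Measurable.mono (comap_measurable _) (le_iSup₂_of_le i hi le_rfl) le_rfl

lemma coordSigma_le (I : Set ℤ) : coordSigma 𝓧 I ≤ MeasurableSpace.pi :=
  iSup₂_le fun i _ => (measurable_pi_apply i).comap_le

lemma coordSigma_mono {I J : Set ℤ} (h : I ⊆ J) : coordSigma 𝓧 I ≤ coordSigma 𝓧 J :=
  biSup_mono h

lemma comap_shift_coordSigma_le (I : Set ℤ) (k : ℕ) :
    (coordSigma 𝓧 I).comap shift^[k] ≤ coordSigma 𝓧 ((fun i => i + (k : ℤ)) '' I) := by
  rw [coordSigma, MeasurableSpace.comap_iSup]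
  refine iSup_le fun i => ?_
  rw [MeasurableSpace.comap_iSup]
  refine iSup_le fun hi => ?_
  rw [MeasurableSpace.comap_comp]
  have : (fun e : ℤ → 𝓧 => e i) ∘ shift^[k] = fun e => e (i + k) := by
    funext e
    simp [shift_iterate]
  rw [this]
  exact le_iSup₂_of_le (f := fun j (_ : j ∈ (fun i => i + (k : ℤ)) '' I) =>
    MeasurableSpace.comap (fun e : ℤ → 𝓧 => e j) inferInstance) (i + k)
    (Set.mem_image_of_mem _ hi) le_rfl

variable (𝓧) in
/-- The filtration generated by the coordinates in growing intervals around `0`. -/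
def intervalFiltration : Filtration ℕ (MeasurableSpace.pi (X := fun _ : ℤ => 𝓧)) where
  seq n := coordSigma 𝓧 (Set.Icc (-n) n)
  mono' m n hmn := coordSigma_mono (Set.Icc_subset_Icc (by lia) (by lia))
  le' n := coordSigma_le _

lemma iSup_intervalFiltration :
    ⨆ n, intervalFiltration 𝓧 n = (MeasurableSpace.pi : MeasurableSpace (ℤ → 𝓧)) := by
  refine le_antisymm (iSup_le fun n => coordSigma_le _) (iSup_le fun i => ?_)
  refine le_iSup_of_le i.natAbs ?_
  exact le_iSup₂_of_le (f := fun j (_ : j ∈ Set.Icc (-(i.natAbs : ℤ)) i.natAbs) =>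
    MeasurableSpace.comap (fun e : ℤ → 𝓧 => e j) inferInstance) i
    ⟨by lia, by lia⟩ le_rfl

variable (ρ : Measure 𝓧) [IsProbabilityMeasure ρ]

lemma measurePreserving_shift : MeasurePreserving shift
    (Measure.infinitePi fun _ : ℤ => ρ) (Measure.infinitePi fun _ : ℤ => ρ) :=
  ⟨measurable_shift, Measure.map_infinitePi_infinitePi_of_inj (P := fun _ : ℤ => ρ)
    (f := fun x : ℤ => x + 1) (add_left_injective 1)⟩

lemma indep_coordSigma {I J : Set ℤ} (h : Disjoint I J) :
    Indep (coordSigma 𝓧 I) (coordSigma 𝓧 J) (Measure.infinitePi fun _ : ℤ => ρ) :=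
  indep_iSup_of_disjoint (fun i => (measurable_pi_apply i).comap_le)
    (iIndepFun_infinitePi (P := fun _ : ℤ => ρ) (X := fun _ e => e)
      fun _ => measurable_id) h

/-- Translates of `g` by at least `2 * n + 1` depend on disjoint sets of coordinates. Along each
residue class modulo `2 * n + 1` they are therefore pairwise independent and identically
distributed, and the strong law applies. -/
lemma ae_tendsto_birkhoffSum_of_interval {n : ℕ} {g : (ℤ → 𝓧) → ℝ}
    (hg : Measurable[coordSigma 𝓧 (Set.Icc (-n) n)] g)
    (hgi : Integrable g (Measure.infinitePi fun _ : ℤ => ρ)) :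
    ∀ᵐ e ∂(Measure.infinitePi fun _ : ℤ => ρ),
      Tendsto (fun k : ℕ => birkhoffSum shift g k e / k) atTop
        (𝓝 (∫ e, g e ∂(Measure.infinitePi fun _ : ℤ => ρ))) := by
  set ν := Measure.infinitePi fun _ : ℤ => ρ
  have hT := measurePreserving_shift ρ
  have hgm : Measurable g := hg.mono (coordSigma_le _) le_rfl
  have hident (k l : ℕ) : IdentDistrib (g ∘ shift^[k]) (g ∘ shift^[l]) ν ν :=
    ⟨(hgm.comp (hT.iterate k).measurable).aemeasurable,
      (hgm.comp (hT.iterate l).measurable).aemeasurable, by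
      rw [← Measure.map_map hgm (hT.iterate k).measurable,
        ← Measure.map_map hgm (hT.iterate l).measurable, (hT.iterate k).map_eq,
        (hT.iterate l).map_eq]⟩
  have hcomap (k : ℕ) : MeasurableSpace.comap (g ∘ shift^[k]) inferInstance ≤
      coordSigma 𝓧 ((fun i => i + (k : ℤ)) '' Set.Icc (-n) n) := by
    rw [← MeasurableSpace.comap_comp]
    exact (MeasurableSpace.comap_mono hg.comap_le).trans (comap_shift_coordSigma_le _ _)
  have hindep (k l : ℕ) (h : k + (2 * n + 1) ≤ l) :
      IndepFun (g ∘ shift^[k]) (g ∘ shift^[l]) ν := by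
    refine (IndepFun_iff_Indep _ _ _).2
      (indep_of_indep_of_le_right (indep_of_indep_of_le_left (indep_coordSigma ρ ?_) (hcomap k))
        (hcomap l))
    rw [Set.disjoint_left]
    rintro _ ⟨i, hi, rfl⟩ ⟨j, hj, hij⟩
    simp only [Set.mem_Icc] at hi hj hij
    lia
  have hres (r : ℕ) : ∀ᵐ e ∂ν, Tendsto (fun q : ℕ =>
      (∑ j ∈ Finset.range q, g (shift^[r + (2 * n + 1) * j] e)) / q) atTop (𝓝 (∫ e, g e ∂ν)) := by
    have := strong_law_ae_real (μ := ν) (fun j => g ∘ shift^[r + (2 * n + 1) * j])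
      ((hT.iterate _).integrable_comp_of_integrable hgi) ?_ fun j => hident _ _
    · have h0 : ∫ e, (g ∘ shift^[r + (2 * n + 1) * 0]) e ∂ν = ∫ e, g e ∂ν :=
        (hident _ 0).integral_eq
      rw [h0] at this
      exact this
    · intro i j hij
      rcases lt_or_gt_of_ne hij with h | h
      · exact hindep _ _ (by nlinarith)
      · exact (hindep _ _ (by nlinarith)).symm
  filter_upwards [ae_all_iff.2 hres] with e he
  exact tendsto_sum_div_of_residues (a := fun k => g (shift^[k] e)) (L := 2 * n + 1) (by lia) he

/-- The **ergodic theorem** for functions of an i.i.d. sequence. -/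
theorem ae_tendsto_birkhoffSum_infinitePi {f : (ℤ → 𝓧) → ℝ} (hfm : Measurable f)
    (hf : Integrable f (Measure.infinitePi fun _ : ℤ => ρ)) :
    ∀ᵐ e ∂(Measure.infinitePi fun _ : ℤ => ρ),
      Tendsto (fun k : ℕ => birkhoffSum shift f k e / k) atTop
        (𝓝 (∫ e, f e ∂(Measure.infinitePi fun _ : ℤ => ρ))) := by
  set ν := Measure.infinitePi fun _ : ℤ => ρ
  refine ae_tendsto_birkhoffSum_div_of_approx (measurePreserving_shift ρ) hf hfm fun ε hε => ?_
  -- Lévy's upward theorem: conditioning on finitely many coordinates approximates `f` in `L¹`.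
  have hL : Tendsto (fun n => eLpNorm (ν[f | intervalFiltration 𝓧 n] - f) 1 ν) atTop (𝓝 0) :=
    hf.tendsto_eLpNorm_condExp (by
      rw [iSup_intervalFiltration]; exact hfm.stronglyMeasurable)
  obtain ⟨n, hn⟩ := (hL.eventually (ge_mem_nhds (ENNReal.ofReal_pos.2 hε))).exists
  have hmeas : Measurable[intervalFiltration 𝓧 n] (ν[f | intervalFiltration 𝓧 n]) :=
    stronglyMeasurable_condExp.measurable
  refine ⟨ν[f | intervalFiltration 𝓧 n], hmeas.mono (coordSigma_le _) le_rfl,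
    integrable_condExp, ?_, ae_tendsto_birkhoffSum_of_interval ρ hmeas integrable_condExp⟩
  rw [eLpNorm_one_eq_lintegral_enorm, ← ofReal_integral_norm_eq_lintegral_enorm
    (integrable_condExp.sub hf), ENNReal.ofReal_le_ofReal_iff hε.le] at hn
  refine le_trans (le_of_eq (integral_congr_ae (Eventually.of_forall fun e => ?_))) hn
  simp only [Pi.sub_apply, Real.norm_eq_abs]
  exact abs_sub_comm _ _

end Shift

/-! ### Laplace transforms of sequences at the origin -/

section Laplace

variable {a : ℕ → ℝ}

/-- The Laplace transform of the measure on `ℕ` with weights `a`. -/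
def laplace (a : ℕ → ℝ) (l : ℝ) : ℝ := ∑' n : ℕ, Real.exp (-(l * n)) * a n

lemma laplace_zero (a : ℕ → ℝ) : laplace a 0 = ∑' n, a n := by simp [laplace]

lemma exp_mul_le (ha : ∀ n, 0 ≤ a n) {l : ℝ} (hl : 0 ≤ l) (n : ℕ) :
    Real.exp (-(l * n)) * a n ≤ a n :=
  mul_le_of_le_one_left (ha n) (Real.exp_le_one_iff.2 (by simpa using by positivity))

lemma summable_laplace (ha : ∀ n, 0 ≤ a n) (hs : Summable a) {l : ℝ} (hl : 0 ≤ l) :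
    Summable fun n : ℕ => Real.exp (-(l * n)) * a n :=
  hs.of_nonneg_of_le (fun n => mul_nonneg (Real.exp_pos _).le (ha n)) (exp_mul_le ha hl)

lemma laplace_le_zero (ha : ∀ n, 0 ≤ a n) (hs : Summable a) {l : ℝ} (hl : 0 ≤ l) :
    laplace a l ≤ laplace a 0 := by
  rw [laplace_zero]
  exact (summable_laplace ha hs hl).tsum_le_tsum (exp_mul_le ha hl) hs

/-- Jensen's inequality for the Laplace transform. -/
lemma exp_mul_laplace_le (ha : ∀ n, 0 ≤ a n) (hs : Summable a)
    (hs1 : Summable fun n : ℕ => n * a n) (hpos : 0 < laplace a 0) {l : ℝ} (hl : 0 ≤ l) :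
    Real.exp (-(l * ((∑' n : ℕ, n * a n) / laplace a 0))) * laplace a 0 ≤ laplace a l := by
  set m := (∑' n : ℕ, n * a n) / laplace a 0
  have hm : ∑' n : ℕ, n * a n = m * laplace a 0 := (div_mul_cancel₀ _ hpos.ne').symm
  -- This is `exp t ≥ 1 + t` at `t = l * m - l * n`; the linear terms cancel after summation because
  -- `m` is the mean.
  have hterm (n : ℕ) : Real.exp (-(l * m)) * ((1 + l * m) * a n - l * (n * a n)) ≤
      Real.exp (-(l * n)) * a n := by
    have h1 := Real.add_one_le_exp (l * m - l * n)
    have h2 : Real.exp (-(l * n)) = Real.exp (-(l * m)) * Real.exp (l * m - l * n) := by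
      rw [← Real.exp_add]; ring_nf
    rw [h2, mul_assoc]
    refine mul_le_mul_of_nonneg_left ?_ (Real.exp_pos _).le
    nlinarith [mul_le_mul_of_nonneg_right h1 (ha n)]
  have hsum := ((hs.mul_left (1 + l * m)).sub (hs1.mul_left l)).mul_left (Real.exp (-(l * m)))
  have := hsum.tsum_le_tsum hterm (summable_laplace ha hs hl)
  rw [tsum_mul_left, ((hs.mul_left (1 + l * m)).tsum_sub (hs1.mul_left l)), tsum_mul_left,
    tsum_mul_left, hm, ← laplace_zero] at this
  calc _ = Real.exp (-(l * m)) * ((1 + l * m) * laplace a 0 - l * (m * laplace a 0)) := by ring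
    _ ≤ _ := this

/-- Dominated convergence, with `|exp (-(l * n)) - 1| / l ≤ n` for `l > 0`. The derivative is
one-sided since for `l < 0` the series need not converge. -/
lemma hasDerivWithinAt_laplace (ha : ∀ n, 0 ≤ a n) (hs : Summable a)
    (hs1 : Summable fun n : ℕ => n * a n) :
    HasDerivWithinAt (laplace a) (-∑' n : ℕ, n * a n) (Set.Ioi 0) 0 := by
  rw [hasDerivWithinAt_iff_tendsto_slope' (by simp), ← tsum_neg]
  have hlim (n : ℕ) : Tendsto (fun l : ℝ => (Real.exp (-(l * n)) - 1) / l * a n) (𝓝[>] 0)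
      (𝓝 (-(n * a n))) := by
    have hd : HasDerivAt (fun l : ℝ => Real.exp (-(l * n))) (-(n : ℝ)) 0 := by
      simpa using ((hasDerivAt_id (0 : ℝ)).mul_const (n : ℝ)).fun_neg.exp
    have := (hasDerivWithinAt_iff_tendsto_slope' (by simp)).1 (hd.hasDerivWithinAt (s := Set.Ioi 0))
    rw [show -(n * a n) = -(n : ℝ) * a n by ring]
    refine (this.mul_const (a n)).congr fun l => ?_
    simp [slope_def_field]
  have hbound : ∀ᶠ l : ℝ in 𝓝[>] 0, ∀ n : ℕ,
      ‖(Real.exp (-(l * n)) - 1) / l * a n‖ ≤ n * a n := by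
    filter_upwards [self_mem_nhdsWithin] with l hl n
    have hl : 0 < l := hl
    have h1 : Real.exp (-(l * n)) ≤ 1 := Real.exp_le_one_iff.2 (by simpa using by positivity)
    have h2 := Real.add_one_le_exp (-(l * n))
    rw [norm_mul, norm_div, Real.norm_eq_abs, Real.norm_eq_abs, Real.norm_eq_abs,
      abs_of_nonneg (ha n), abs_of_pos hl, abs_of_nonpos (by linarith)]
    refine mul_le_mul_of_nonneg_right ?_ (ha n)
    rw [div_le_iff₀ hl]
    linarith
  refine (tendsto_tsum_of_dominated_convergence hs1 hlim hbound).congr' ?_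
  filter_upwards [self_mem_nhdsWithin] with l hl
  have hl : 0 < l := hl
  rw [slope_def_field, sub_zero, laplace_zero, laplace,
    ← (summable_laplace ha hs hl.le).tsum_sub hs, ← tsum_div_const]
  refine tsum_congr fun n => ?_
  ring

lemma tendsto_log_laplace (ha : ∀ n, 0 ≤ a n) (hs : Summable a)
    (hs1 : Summable fun n : ℕ => n * a n) (hpos : 0 < laplace a 0) :
    Tendsto (fun l => (Real.log (laplace a 0) - Real.log (laplace a l)) / l) (𝓝[>] 0)
      (𝓝 ((∑' n : ℕ, n * a n) / laplace a 0)) := by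
  have h := (hasDerivWithinAt_laplace ha hs hs1).log hpos.ne'
  rw [hasDerivWithinAt_iff_tendsto_slope' (by simp)] at h
  have h2 := h.neg
  rw [neg_div, neg_neg] at h2
  refine h2.congr fun l => ?_
  rw [slope_def_field, sub_zero]
  ring

lemma log_laplace_sub_nonneg (ha : ∀ n, 0 ≤ a n) (hs : Summable a)
    (hs1 : Summable fun n : ℕ => n * a n) (hpos : 0 < laplace a 0) {l : ℝ} (hl : 0 ≤ l) :
    0 ≤ Real.log (laplace a 0) - Real.log (laplace a l) := by
  have h1 := exp_mul_laplace_le ha hs hs1 hpos hl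
  have h2 : 0 < laplace a l := lt_of_lt_of_le (mul_pos (Real.exp_pos _) hpos) h1
  exact sub_nonneg.2 (Real.log_le_log h2 (laplace_le_zero ha hs hl))

lemma log_laplace_sub_le (ha : ∀ n, 0 ≤ a n) (hs : Summable a)
    (hs1 : Summable fun n : ℕ => n * a n) (hpos : 0 < laplace a 0) {l : ℝ} (hl : 0 ≤ l) :
    Real.log (laplace a 0) - Real.log (laplace a l) ≤
      l * ((∑' n : ℕ, n * a n) / laplace a 0) := by
  have h1 := Real.log_le_log (mul_pos (Real.exp_pos _) hpos)
    (exp_mul_laplace_le ha hs hs1 hpos hl)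
  rw [Real.log_mul (Real.exp_pos _).ne' hpos.ne', Real.log_exp] at h1
  linarith

end Laplace

/-! ### One-step functionals of the environment -/

section Functionals

lemma expWeight_le_one {u : ℤ → ℝ} (hu : ∀ x, 0 ≤ u x) (x : ℤ) : expWeight u x ≤ 1 := by
  rw [expWeight, ← ENNReal.ofReal_one]
  exact ENNReal.ofReal_le_ofReal (Real.exp_le_one_iff.2 (by linarith [hu x]))

lemma expWeight_ne_zero (u : ℤ → ℝ) (x : ℤ) : expWeight u x ≠ 0 :=
  (ENNReal.ofReal_pos.2 (Real.exp_pos _)).ne'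

/-- The weights of the potential `l + e`. -/
def envWeight (l : ℝ) (e : ℤ → ℝ≥0) : ℤ → ℝ≥0∞ := expWeight fun x => l + e x

lemma envWeight_zero (e : ℤ → ℝ≥0) : envWeight 0 e = expWeight fun x => e x := by
  simp [envWeight]

lemma envWeight_le_one {l : ℝ} (hl : 0 ≤ l) (e : ℤ → ℝ≥0) (x : ℤ) : envWeight l e x ≤ 1 :=
  expWeight_le_one (fun _ => by positivity) x

lemma envWeight_ne_zero (l : ℝ) (e : ℤ → ℝ≥0) (x : ℤ) : envWeight l e x ≠ 0 :=
  expWeight_ne_zero _ x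

lemma envWeight_eq_mul (l : ℝ) (e : ℤ → ℝ≥0) :
    envWeight l e = fun x => ENNReal.ofReal (Real.exp (-l)) * envWeight 0 e x := by
  funext x
  simp only [envWeight, expWeight]
  rw [← ENNReal.ofReal_mul (Real.exp_pos _).le, ← Real.exp_add]
  ring_nf

lemma measurable_envWeight {mE : MeasurableSpace (ℤ → ℝ≥0)} {x : ℤ}
    (h : Measurable fun e : ℤ → ℝ≥0 => e x) (l : ℝ) :
    Measurable fun e : ℤ → ℝ≥0 => envWeight l e x :=
  ((measurable_const.add h.coe_nnreal_real).neg.exp).ennreal_ofReal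

lemma envWeight_shift_iterate (l : ℝ) (k : ℕ) (e : ℤ → ℝ≥0) :
    envWeight l (shift^[k] e) = fun x => envWeight l e (x + k) := by
  funext x
  simp [envWeight, expWeight, shift_iterate]

lemma crossWeight_shift_iterate (l : ℝ) (k : ℕ) (e : ℤ → ℝ≥0) (y x : ℤ) :
    crossWeight (envWeight l (shift^[k] e)) y x = crossWeight (envWeight l e) (y + k) (x + k) := by
  simp [crossWeight, envWeight_shift_iterate, pathWeight_shift]

lemma stepMean_shift_iterate (l : ℝ) (c : ℕ → ℝ≥0∞) (k : ℕ) (e : ℤ → ℝ≥0) (x : ℤ) :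
    stepMean (envWeight l (shift^[k] e)) c x = stepMean (envWeight l e) c (x + k) := by
  simp [stepMean, crossSum, crossWeight, envWeight_shift_iterate, pathWeight_shift,
    add_right_comm]

/-- The one-step free energy in the potential `l + e`. -/
def freeEnergy (l : ℝ) (e : ℤ → ℝ≥0) : ℝ :=
  -Real.log (crossWeight (envWeight l e) 1 0).toReal

/-- The mean crossing time from `0` to `1` in the potential `e`. -/
def stepTime (e : ℤ → ℝ≥0) : ℝ≥0∞ := stepMean (envWeight 0 e) (fun n => n) 0

lemma measurable_freeEnergy (l : ℝ) : Measurable (freeEnergy l) :=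
  (measurable_crossWeight (w := envWeight l)
    (fun z _ => measurable_envWeight (measurable_pi_apply z) l)
    (by simp)).ennreal_toReal.log.neg

lemma measurable_stepTime : Measurable stepTime :=
  measurable_stepMean (w := envWeight 0)
    (fun z _ => measurable_envWeight (measurable_pi_apply z) 0) _

lemma one_le_stepTime (e : ℤ → ℝ≥0) : 1 ≤ stepTime e :=
  one_le_stepMean (envWeight_le_one le_rfl e) (envWeight_ne_zero 0 e) 0

lemma toReal_crossWeight_pos {l : ℝ} (hl : 0 ≤ l) (e : ℤ → ℝ≥0) {x y : ℤ} (h : x ≤ y) :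
    0 < (crossWeight (envWeight l e) y x).toReal :=
  ENNReal.toReal_pos (crossWeight_pos (envWeight_ne_zero l e) h)
    (crossWeight_ne_top (envWeight_le_one hl e) y x)

lemma freeEnergy_nonneg {l : ℝ} (hl : 0 ≤ l) (e : ℤ → ℝ≥0) : 0 ≤ freeEnergy l e := by
  rw [freeEnergy, neg_nonneg]
  refine Real.log_nonpos ENNReal.toReal_nonneg ?_
  exact ENNReal.toReal_le_of_le_ofReal zero_le_one
    (by simpa using crossWeight_le_one (envWeight_le_one hl e) 1 0)

/-- Only the path that steps to `1` immediately is kept. -/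
lemma freeEnergy_le {l : ℝ} (hl : 0 ≤ l) (e : ℤ → ℝ≥0) :
    freeEnergy l e ≤ l + e 0 + Real.log 2 := by
  have h := le_crossWeight_step (w := envWeight l e) 0
  rw [zero_add] at h
  have h2 := ENNReal.toReal_mono (crossWeight_ne_top (envWeight_le_one hl e) 1 0) h
  rw [ENNReal.toReal_mul, envWeight, expWeight, ENNReal.toReal_ofReal (Real.exp_pos _).le,
    ENNReal.toReal_inv, ENNReal.toReal_ofNat] at h2
  have h3 := Real.log_le_log (by positivity) h2
  rw [Real.log_mul (Real.exp_pos _).ne' (by norm_num), Real.log_exp, Real.log_inv] at h3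
  rw [freeEnergy, envWeight]
  linarith

/-- The free energy as the logarithm of a Laplace transform. -/
lemma toReal_crossWeight_eq_laplace {l : ℝ} (e : ℤ → ℝ≥0) :
    (crossWeight (envWeight l e) 1 0).toReal =
      laplace (fun n => (pathWeight (envWeight 0 e) 1 n 0).toReal) l := by
  have hfin (n : ℕ) : pathWeight (envWeight 0 e) 1 n 0 ≠ ⊤ :=
    ENNReal.ne_top_of_tsum_ne_top (crossWeight_ne_top (envWeight_le_one le_rfl e) 1 0) n
  rw [crossWeight, envWeight_eq_mul]
  simp_rw [pathWeight_const_mul]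
  rw [ENNReal.tsum_toReal_eq fun n =>
    ENNReal.mul_ne_top (ENNReal.pow_ne_top ENNReal.ofReal_ne_top) (hfin n), laplace]
  refine tsum_congr fun n => ?_
  rw [ENNReal.toReal_mul, ENNReal.toReal_pow, ENNReal.toReal_ofReal (Real.exp_pos _).le,
    ← Real.exp_nat_mul]
  ring_nf

lemma summable_toReal_pathWeight (e : ℤ → ℝ≥0) :
    Summable fun n => (pathWeight (envWeight 0 e) 1 n 0).toReal :=
  ENNReal.summable_toReal (crossWeight_ne_top (envWeight_le_one le_rfl e) 1 0)

lemma crossTime_ne_top {e : ℤ → ℝ≥0} (h : stepTime e ≠ ⊤) :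
    ∑' n : ℕ, (n : ℝ≥0∞) * pathWeight (envWeight 0 e) 1 n 0 ≠ ⊤ := by
  intro htop
  refine h ?_
  rw [stepTime, stepMean, crossSum, zero_add, htop,
    ENNReal.top_div_of_ne_top (crossWeight_ne_top (envWeight_le_one le_rfl e) 1 0)]

lemma summable_mul_toReal_pathWeight {e : ℤ → ℝ≥0} (h : stepTime e ≠ ⊤) :
    Summable fun n : ℕ => n * (pathWeight (envWeight 0 e) 1 n 0).toReal := by
  simpa [ENNReal.toReal_mul] using ENNReal.summable_toReal (crossTime_ne_top h)

lemma toReal_stepTime {e : ℤ → ℝ≥0} (h : stepTime e ≠ ⊤) : (stepTime e).toReal =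
    (∑' n : ℕ, n * (pathWeight (envWeight 0 e) 1 n 0).toReal) /
      laplace (fun n => (pathWeight (envWeight 0 e) 1 n 0).toReal) 0 := by
  rw [← toReal_crossWeight_eq_laplace, stepTime, stepMean, ENNReal.toReal_div, zero_add, crossSum,
    ENNReal.tsum_toReal_eq fun n => ENNReal.ne_top_of_tsum_ne_top (crossTime_ne_top h) n]
  simp [ENNReal.toReal_mul]

lemma freeEnergy_sub_nonneg {e : ℤ → ℝ≥0} (h : stepTime e ≠ ⊤) {l : ℝ} (hl : 0 ≤ l) :
    0 ≤ freeEnergy l e - freeEnergy 0 e := by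
  have hpos := toReal_crossWeight_pos le_rfl e zero_le_one
  rw [toReal_crossWeight_eq_laplace] at hpos
  have := log_laplace_sub_nonneg (fun n => ENNReal.toReal_nonneg) (summable_toReal_pathWeight e)
    (summable_mul_toReal_pathWeight h) hpos hl
  rw [freeEnergy, freeEnergy, toReal_crossWeight_eq_laplace, toReal_crossWeight_eq_laplace]
  linarith

/-- Jensen's inequality in a form uniform in `l`: `stepTime` dominates all difference quotients. -/
lemma freeEnergy_sub_le {e : ℤ → ℝ≥0} (h : stepTime e ≠ ⊤) {l : ℝ} (hl : 0 ≤ l) :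
    freeEnergy l e - freeEnergy 0 e ≤ l * (stepTime e).toReal := by
  have hpos := toReal_crossWeight_pos le_rfl e zero_le_one
  rw [toReal_crossWeight_eq_laplace] at hpos
  have := log_laplace_sub_le (fun n => ENNReal.toReal_nonneg) (summable_toReal_pathWeight e)
    (summable_mul_toReal_pathWeight h) hpos hl
  rw [freeEnergy, freeEnergy, toReal_crossWeight_eq_laplace, toReal_crossWeight_eq_laplace,
    toReal_stepTime h]
  linarith

lemma tendsto_freeEnergy_sub_div {e : ℤ → ℝ≥0} (h : stepTime e ≠ ⊤) :
    Tendsto (fun l => (freeEnergy l e - freeEnergy 0 e) / l) (𝓝[>] 0)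
      (𝓝 (stepTime e).toReal) := by
  have hpos := toReal_crossWeight_pos le_rfl e zero_le_one
  rw [toReal_crossWeight_eq_laplace] at hpos
  rw [toReal_stepTime h]
  refine (tendsto_log_laplace (fun n => ENNReal.toReal_nonneg) (summable_toReal_pathWeight e)
    (summable_mul_toReal_pathWeight h) hpos).congr fun l => ?_
  rw [freeEnergy, freeEnergy, toReal_crossWeight_eq_laplace, toReal_crossWeight_eq_laplace]
  ring

end Functionals

/-! ### Integrability of the crossing time -/

section Integrability

/-- The identity truncated at `N`. -/
def cutoff (N n : ℕ) : ℝ≥0∞ := if n < N then n else 0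

lemma cutoff_le (N n : ℕ) : cutoff N n ≤ N := by
  unfold cutoff
  split_ifs with h
  · exact_mod_cast h.le
  · exact zero_le

/-- If `k + l < N` then neither summand is cut off; otherwise the left side is `0`. Truncating to
`0` rather than to `N` also makes the truncated sums exactly the partial sums of the series. -/
lemma cutoff_add_le (N k l : ℕ) : cutoff N (k + l) ≤ cutoff N k + cutoff N l := by
  unfold cutoff
  by_cases h : k + l < N
  · rw [if_pos h, if_pos (by lia), if_pos (by lia)]
    push_cast
    exact le_rfl
  · rw [if_neg h]
    exact zero_le

lemma cutoff_succ_le (N n : ℕ) : cutoff N (n + 1) ≤ 1 + cutoff N n := by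
  refine (cutoff_add_le N n 1).trans ?_
  rw [add_comm]
  gcongr
  unfold cutoff
  split_ifs <;> simp

lemma cutoff_mono (n : ℕ) : Monotone fun N => cutoff N n := by
  intro M N hMN
  unfold cutoff
  dsimp only
  split_ifs with h1 h2
  · exact le_rfl
  · exact absurd (h1.trans_le hMN) h2
  · exact zero_le
  · exact le_rfl

lemma monotone_stepMean_cutoff (w : ℤ → ℝ≥0∞) (x : ℤ) :
    Monotone fun N => stepMean w (cutoff N) x := by
  intro M N hMN
  simp only [stepMean, crossSum]
  gcongr
  exact cutoff_mono _ hMN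

lemma iSup_stepMean_cutoff (w : ℤ → ℝ≥0∞) (x : ℤ) :
    ⨆ N, stepMean w (cutoff N) x = stepMean w (fun n => n) x := by
  simp only [stepMean]
  rw [← ENNReal.iSup_div]
  congr 1
  simp only [crossSum]
  rw [ENNReal.tsum_eq_iSup_nat]
  congr 1
  funext N
  rw [tsum_eq_sum (s := Finset.range N)]
  · refine Finset.sum_congr rfl fun n hn => ?_
    rw [cutoff, if_pos (Finset.mem_range.1 hn)]
  · intro n hn
    rw [cutoff, if_neg (by simpa using hn), zero_mul]

variable (ρ : Measure ℝ≥0) [IsProbabilityMeasure ρ]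

/-- This is where the nondegeneracy of the potential enters; it reaches the later results only
through the finiteness of the mean crossing time. -/
lemma lintegral_envWeight_lt_one (hρ : ρ {x | 0 < x} ≠ 0) :
    ∫⁻ e, envWeight 0 e 0 ∂(Measure.infinitePi fun _ : ℤ => ρ) < 1 := by
  have hmp := measurePreserving_eval_infinitePi (fun _ : ℤ => ρ) 0
  have h1 : ∫⁻ e, envWeight 0 e 0 ∂(Measure.infinitePi fun _ : ℤ => ρ) =
      ∫⁻ x : ℝ≥0, ENNReal.ofReal (Real.exp (-(x : ℝ))) ∂ρ := by
    rw [← hmp.lintegral_comp (by fun_prop)]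
    simp [envWeight, expWeight]
  have hle (x : ℝ≥0) : ENNReal.ofReal (Real.exp (-(x : ℝ))) ≤ 1 := by
    simp
  rw [h1, ← (by simp : ∫⁻ _ : ℝ≥0, (1 : ℝ≥0∞) ∂ρ = 1)]
  refine lintegral_strict_mono_of_ae_le_of_ae_lt_on aemeasurable_const ?_
    (Eventually.of_forall hle) hρ (Eventually.of_forall fun x hx => ?_)
  · exact ((lintegral_mono hle).trans_lt (by simp)).ne
  · have hx : 0 < x := hx
    rw [← ENNReal.ofReal_one, ENNReal.ofReal_lt_ofReal_iff one_pos, Real.exp_lt_one_iff]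
    simpa using hx

/-- The recursion is integrated. The mean at `-1` depends only on sites below `0`, hence is
independent of the weight at `0`, and the shift carries it to the mean at `0`. -/
lemma lintegral_stepMean_cutoff_le (N : ℕ) :
    ∫⁻ e, stepMean (envWeight 0 e) (cutoff N) 0 ∂(Measure.infinitePi fun _ : ℤ => ρ) ≤
      2 + (∫⁻ e, envWeight 0 e 0 ∂(Measure.infinitePi fun _ : ℤ => ρ)) *
        ∫⁻ e, stepMean (envWeight 0 e) (cutoff N) 0 ∂(Measure.infinitePi fun _ : ℤ => ρ) := by
  set ν := Measure.infinitePi fun _ : ℤ => ρ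
  have hbd (e : ℤ → ℝ≥0) : stepMean (envWeight 0 e) (cutoff N) 0 ≠ ⊤ :=
    ((stepMean_le_of_le (cutoff_le N) 0).trans_lt (ENNReal.natCast_lt_top N)).ne
  have hm (x : ℤ) : Measurable fun e => stepMean (envWeight 0 e) (cutoff N) x :=
    measurable_stepMean (fun z _ => measurable_envWeight (measurable_pi_apply z) 0) _
  have hshift : ∫⁻ e, stepMean (envWeight 0 e) (cutoff N) (0 - 1) ∂ν =
      ∫⁻ e, stepMean (envWeight 0 e) (cutoff N) 0 ∂ν := by
    rw [← (measurePreserving_shift ρ).lintegral_comp (hm (0 - 1))]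
    refine lintegral_congr fun e => ?_
    simpa using stepMean_shift_iterate 0 (cutoff N) 1 e (0 - 1)
  have hind : ∫⁻ e, envWeight 0 e 0 * stepMean (envWeight 0 e) (cutoff N) (0 - 1) ∂ν =
      (∫⁻ e, envWeight 0 e 0 ∂ν) * ∫⁻ e, stepMean (envWeight 0 e) (cutoff N) (0 - 1) ∂ν :=
    lintegral_mul_eq_lintegral_mul_lintegral_of_independent_measurableSpace
      (coordSigma_le _) (coordSigma_le _)
      (indep_coordSigma (I := {0}) (J := Set.Iio 0) ρ (by simp))
      (measurable_envWeight (measurable_coord (Set.mem_singleton 0)) 0)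
      (measurable_stepMean (fun z hz =>
        measurable_envWeight (measurable_coord (show z ∈ Set.Iio 0 by simp; lia)) 0) _)
  calc ∫⁻ e, stepMean (envWeight 0 e) (cutoff N) 0 ∂ν
      ≤ ∫⁻ e, (2 + envWeight 0 e 0 * stepMean (envWeight 0 e) (cutoff N) (0 - 1)) ∂ν :=
        lintegral_mono fun e => stepMean_le_two_add (envWeight_le_one le_rfl e)
          (envWeight_ne_zero 0 e) (by simp [cutoff]) (cutoff_succ_le N) (cutoff_add_le N) (hbd e)
    _ = _ := by
      rw [lintegral_add_left measurable_const, hind, hshift]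
      simp

lemma lintegral_stepTime_lt_top (hρ : ρ {x | 0 < x} ≠ 0) :
    ∫⁻ e, stepTime e ∂(Measure.infinitePi fun _ : ℤ => ρ) < ⊤ := by
  set ν := Measure.infinitePi fun _ : ℤ => ρ
  set θ := ∫⁻ e, envWeight 0 e 0 ∂ν with hθdef
  have hθ : θ < 1 := lintegral_envWeight_lt_one ρ hρ
  have hbound (N : ℕ) :
      ∫⁻ e, stepMean (envWeight 0 e) (cutoff N) 0 ∂ν ≤ 2 / (1 - θ) := by
    set I := ∫⁻ e, stepMean (envWeight 0 e) (cutoff N) 0 ∂ν with hI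
    -- Truncation makes `I ≤ N`, so `θ * I` may be subtracted; the resulting bound does not depend
    -- on `N`.
    have hfin : I ≠ ⊤ := by
      refine ((lintegral_mono fun e => stepMean_le_of_le (cutoff_le N) 0).trans_lt ?_).ne
      simp
    have h := lintegral_stepMean_cutoff_le ρ N
    rw [ENNReal.le_div_iff_mul_le (.inl (tsub_pos_of_lt hθ).ne')
      (.inl (ENNReal.sub_ne_top ENNReal.one_ne_top)), ENNReal.mul_sub fun _ _ => hfin, mul_one]
    refine tsub_le_iff_right.2 ?_
    rw [mul_comm I θ]
    exact h
  have hm (N : ℕ) : Measurable fun e => stepMean (envWeight 0 e) (cutoff N) 0 :=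
    measurable_stepMean (fun z _ => measurable_envWeight (measurable_pi_apply z) 0) _
  have hsup : ∫⁻ e, stepTime e ∂ν = ⨆ N, ∫⁻ e, stepMean (envWeight 0 e) (cutoff N) 0 ∂ν := by
    rw [← lintegral_iSup hm fun M N hMN e => monotone_stepMean_cutoff _ 0 hMN]
    refine lintegral_congr fun e => ?_
    rw [stepTime, iSup_stepMean_cutoff]
  rw [hsup]
  refine (iSup_le hbound).trans_lt ?_
  exact ENNReal.div_lt_top (by simp) (tsub_pos_of_lt hθ).ne'

lemma one_le_lintegral_stepTime :
    1 ≤ ∫⁻ e, stepTime e ∂(Measure.infinitePi fun _ : ℤ => ρ) := by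
  calc (1 : ℝ≥0∞) = ∫⁻ _, 1 ∂(Measure.infinitePi fun _ : ℤ => ρ) := by simp
    _ ≤ _ := lintegral_mono one_le_stepTime

variable {ρ}

lemma integrable_freeEnergy (hint : Integrable (fun x : ℝ≥0 => (x : ℝ)) ρ) {l : ℝ} (hl : 0 ≤ l) :
    Integrable (freeEnergy l) (Measure.infinitePi fun _ : ℤ => ρ) := by
  have hmp := measurePreserving_eval_infinitePi (fun _ : ℤ => ρ) 0
  have h0 : Integrable (fun e : ℤ → ℝ≥0 => (e 0 : ℝ)) (Measure.infinitePi fun _ : ℤ => ρ) :=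
    hmp.integrable_comp_of_integrable hint
  refine (((integrable_const l).add h0).add (integrable_const (Real.log 2))).mono'
    (measurable_freeEnergy l).aestronglyMeasurable (Eventually.of_forall fun e => ?_)
  rw [Real.norm_eq_abs, abs_of_nonneg (freeEnergy_nonneg hl e)]
  exact freeEnergy_le hl e

lemma ae_stepTime_ne_top (hρ : ρ {x | 0 < x} ≠ 0) :
    ∀ᵐ e ∂(Measure.infinitePi fun _ : ℤ => ρ), stepTime e ≠ ⊤ :=
  (ae_lt_top measurable_stepTime (lintegral_stepTime_lt_top ρ hρ).ne).mono fun _ h => h.ne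

lemma integrable_stepTime (hρ : ρ {x | 0 < x} ≠ 0) :
    Integrable (fun e => (stepTime e).toReal) (Measure.infinitePi fun _ : ℤ => ρ) :=
  integrable_toReal_of_lintegral_ne_top measurable_stepTime.aemeasurable
    (lintegral_stepTime_lt_top ρ hρ).ne

lemma integral_stepTime (hρ : ρ {x | 0 < x} ≠ 0) :
    ∫ e, (stepTime e).toReal ∂(Measure.infinitePi fun _ : ℤ => ρ) =
      (∫⁻ e, stepTime e ∂(Measure.infinitePi fun _ : ℤ => ρ)).toReal :=
  integral_toReal measurable_stepTime.aemeasurable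
    (ae_lt_top measurable_stepTime (lintegral_stepTime_lt_top ρ hρ).ne)

/-- The right derivative at `0` of the mean free energy is the mean crossing time. -/
lemma hasDerivWithinAt_integral_freeEnergy (hρ : ρ {x | 0 < x} ≠ 0)
    (hint : Integrable (fun x : ℝ≥0 => (x : ℝ)) ρ) :
    HasDerivWithinAt (fun l => ∫ e, freeEnergy l e ∂(Measure.infinitePi fun _ : ℤ => ρ))
      (∫⁻ e, stepTime e ∂(Measure.infinitePi fun _ : ℤ => ρ)).toReal (Set.Ici 0) 0 := by
  rw [← hasDerivWithinAt_Ioi_iff_Ici, hasDerivWithinAt_iff_tendsto_slope' (by simp),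
    ← integral_stepTime hρ]
  set ν := Measure.infinitePi fun _ : ℤ => ρ
  have hlim : Tendsto (fun l => ∫ e, (freeEnergy l e - freeEnergy 0 e) / l ∂ν) (𝓝[>] 0)
      (𝓝 (∫ e, (stepTime e).toReal ∂ν)) := by
    refine tendsto_integral_filter_of_dominated_convergence (fun e => (stepTime e).toReal) ?_ ?_
      (integrable_stepTime hρ) ?_
    · exact Eventually.of_forall fun l =>
        (((measurable_freeEnergy l).sub (measurable_freeEnergy 0)).div_const l).aestronglyMeasurable
    · filter_upwards [self_mem_nhdsWithin] with l hl
      have hl : 0 < l := hl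
      filter_upwards [ae_stepTime_ne_top hρ] with e he
      rw [Real.norm_eq_abs, abs_of_nonneg (div_nonneg (freeEnergy_sub_nonneg he hl.le) hl.le),
        div_le_iff₀ hl, mul_comm]
      exact freeEnergy_sub_le he hl.le
    · filter_upwards [ae_stepTime_ne_top hρ] with e he
      exact tendsto_freeEnergy_sub_div he
  refine hlim.congr' ?_
  filter_upwards [self_mem_nhdsWithin] with l hl
  have hl : 0 < l := hl
  rw [slope_def_field, sub_zero, integral_div, integral_sub (integrable_freeEnergy hint hl.le)
    (integrable_freeEnergy hint le_rfl)]

/-- The logarithm of the product formula is a Birkhoff sum of `freeEnergy`. -/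
lemma ae_tendsto_log_crossWeight (hint : Integrable (fun x : ℝ≥0 => (x : ℝ)) ρ) {l : ℝ}
    (hl : 0 ≤ l) : ∀ᵐ e ∂(Measure.infinitePi fun _ : ℤ => ρ), Tendsto
      (fun y : ℕ => -((1 / (y : ℝ)) * Real.log (crossWeight (envWeight l e) y 0).toReal)) atTop
      (𝓝 (∫ e, freeEnergy l e ∂(Measure.infinitePi fun _ : ℤ => ρ))) := by
  filter_upwards [ae_tendsto_birkhoffSum_infinitePi ρ (measurable_freeEnergy l)
    (integrable_freeEnergy hint hl)] with e he
  refine he.congr fun y => ?_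
  have hlog : Real.log (crossWeight (envWeight l e) y 0).toReal =
      ∑ x ∈ Finset.range y, Real.log (crossWeight (envWeight l e) (x + 1) x).toReal := by
    rw [crossWeight_eq_prod, ENNReal.toReal_prod, Real.log_prod]
    exact fun x _ => (toReal_crossWeight_pos hl e (by simp)).ne'
  rw [hlog, birkhoffSum]
  simp only [freeEnergy, crossWeight_shift_iterate, Finset.sum_neg_distrib, zero_add,
    add_comm (1 : ℤ)]
  ring

lemma ae_tendsto_crossTime_div (hρ : ρ {x | 0 < x} ≠ 0) :
    ∀ᵐ e ∂(Measure.infinitePi fun _ : ℤ => ρ), Tendsto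
      (fun y : ℕ => crossTime (envWeight 0 e) y 0 / crossWeight (envWeight 0 e) y 0 / y) atTop
      (𝓝 (∫⁻ e, stepTime e ∂(Measure.infinitePi fun _ : ℤ => ρ))) := by
  set ν := Measure.infinitePi fun _ : ℤ => ρ
  -- Finiteness along the whole orbit lets the real Birkhoff sum be read back in `[0, ∞]`.
  have hfin : ∀ᵐ e ∂ν, ∀ k : ℕ, stepTime (shift^[k] e) ≠ ⊤ :=
    ae_all_iff.2 fun k =>
      ((measurePreserving_shift ρ).iterate k).quasiMeasurePreserving.ae (ae_stepTime_ne_top hρ)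
  filter_upwards [ae_tendsto_birkhoffSum_infinitePi ρ measurable_stepTime.ennreal_toReal
    (integrable_stepTime hρ), hfin] with e he hfe
  rw [integral_stepTime hρ] at he
  have h := ENNReal.tendsto_ofReal he
  rw [ENNReal.ofReal_toReal (lintegral_stepTime_lt_top ρ hρ).ne] at h
  refine h.congr' ?_
  filter_upwards [eventually_gt_atTop 0] with y hy
  rw [ENNReal.ofReal_div_of_pos (by exact_mod_cast hy), ENNReal.ofReal_natCast,
    crossTime_div_crossWeight (envWeight_le_one le_rfl e) (envWeight_ne_zero 0 e), birkhoffSum,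
    ENNReal.ofReal_sum_of_nonneg fun _ _ => ENNReal.toReal_nonneg]
  congr 1
  refine Finset.sum_congr rfl fun k _ => ?_
  rw [ENNReal.ofReal_toReal (hfe k), stepTime, stepMean_shift_iterate, zero_add]

end Integrability

end CrossingSpeed

end

/-! ### Transfer to the given probability space -/

theorem proposition2p2 {Ω : Type*} [MeasurableSpace Ω] (μ : Measure Ω) [IsProbabilityMeasure μ]
    (V : ℤ → Ω → ℝ)
    (hmeas : ∀ x, Measurable (V x))
    (hindep : iIndepFun V μ)
    (hident : ∀ x, IdentDistrib (V x) (V 0) μ μ)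
    (hnonneg : ∀ᵐ ω ∂μ, 0 ≤ V 0 ω)
    (hpos : 0 < μ {ω | 0 < V 0 ω})
    (hint : Integrable (V 0) μ) :
    ∃ v : ℝ, CrossingSpeed.IsQuenchedSpeed μ V v ∧
      AEMeasurable
        (fun ω => CrossingSpeed.meanCrossingTime (CrossingSpeed.environment V ω) 1) μ ∧
      ∫⁻ ω, CrossingSpeed.meanCrossingTime (CrossingSpeed.environment V ω) 1 ∂μ < ∞ ∧
      ENNReal.ofReal (1 / v) =
        ∫⁻ ω, CrossingSpeed.meanCrossingTime (CrossingSpeed.environment V ω) 1 ∂μ ∧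
      ∃ α : ℝ → ℝ,
        (∀ l : ℝ, 0 ≤ l →
          CrossingSpeed.IsQuenchedLyapunovExponent μ (fun x ω => l + V x ω) (α l)) ∧
        HasDerivWithinAt α (1 / v) (Set.Ici 0) 0 := by
  open CrossingSpeed in
  have henv : Measurable (environment V) :=
    measurable_pi_lambda _ fun x => (hmeas x).real_toNNReal
  set ρ : Measure ℝ≥0 := μ.map fun ω => (V 0 ω).toNNReal with hρdef
  have hm0 : Measurable fun ω => (V 0 ω).toNNReal := (hmeas 0).real_toNNReal
  have : IsProbabilityMeasure ρ := Measure.isProbabilityMeasure_map hm0.aemeasurable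
  have hlaw : μ.map (environment V) = Measure.infinitePi fun _ : ℤ => ρ := by
    have h1 : iIndepFun (fun x ω => (V x ω).toNNReal) μ :=
      hindep.comp (fun _ => Real.toNNReal) fun _ => measurable_real_toNNReal
    have h2 := h1.map_fun_eq_infinitePi_map fun x => (hmeas x).real_toNNReal
    have h3 (x : ℤ) : μ.map (fun ω => (V x ω).toNNReal) = ρ :=
      ((hident x).comp measurable_real_toNNReal).map_eq
    simp only [h3] at h2
    exact h2
  have hρ : ρ {x | 0 < x} ≠ 0 := by
    have hset : MeasurableSet {x : ℝ≥0 | 0 < x} := measurableSet_Ioi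
    rw [hρdef, Measure.map_apply hm0 hset]
    simpa using hpos.ne'
  have hρint : Integrable (fun x : ℝ≥0 => (x : ℝ)) ρ := by
    rw [hρdef, integrable_map_measure (by fun_prop) hm0.aemeasurable]
    refine hint.congr ?_
    filter_upwards [hnonneg] with ω hω
    simp [hω]
  -- Since there are countably many sites, taking positive parts almost surely changes the potential
  -- nowhere.
  have hV : ∀ᵐ ω ∂μ, ∀ x, ((environment V ω x : ℝ≥0) : ℝ) = V x ω := by
    refine ae_all_iff.2 fun x => ?_
    have : ∀ᵐ ω ∂μ, 0 ≤ V x ω :=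
      (hident x).symm.ae_snd (p := fun r => 0 ≤ r) measurableSet_Ici hnonneg
    filter_upwards [this] with ω hω
    exact Real.coe_toNNReal _ hω
  have hmean (ω : Ω) (y : ℤ) (hy : y ≠ 0) : meanCrossingTime (environment V ω) y =
      crossTime (envWeight 0 (environment V ω)) y 0 /
        crossWeight (envWeight 0 (environment V ω)) y 0 := by
    rw [meanCrossingTime_eq _ hy, envWeight_zero]
  have hmean1 : (fun ω => meanCrossingTime (environment V ω) 1) =
      fun ω => stepTime (environment V ω) := by
    funext ω
    rw [hmean ω 1 one_ne_zero, stepTime, stepMean, crossTime_eq_crossSum, zero_add]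
  set M := ∫⁻ e, stepTime e ∂(Measure.infinitePi fun _ : ℤ => ρ) with hM
  have hMtop : M < ⊤ := lintegral_stepTime_lt_top ρ hρ
  have hM1 : 1 ≤ M := one_le_lintegral_stepTime ρ
  have hMpos : 0 < M.toReal := ENNReal.toReal_pos (one_pos.trans_le hM1).ne' hMtop.ne
  have hMint : ∫⁻ ω, meanCrossingTime (environment V ω) 1 ∂μ = M := by
    rw [hmean1, hM, ← hlaw, lintegral_map measurable_stepTime henv]
  -- The speed is the inverse of the mean one-step time; it is positive and finite because `1 ≤ M <
  -- ⊤`.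
  refine ⟨1 / M.toReal, ⟨by positivity, ?_⟩, ?_, ?_, ?_,
    fun l => ∫ e, freeEnergy l e ∂(Measure.infinitePi fun _ : ℤ => ρ), fun l hl => ?_, ?_⟩
  · rw [one_div_one_div, ENNReal.ofReal_toReal hMtop.ne]
    have h := ae_tendsto_crossTime_div hρ
    rw [← hlaw] at h
    filter_upwards [ae_of_ae_map henv.aemeasurable h] with ω hω
    -- The earlier rewriting by `hlaw` also changed the measure inside the limit; this restores it.
    rw [hlaw] at hω
    refine hω.congr' ?_
    -- For `y = 0` the hitting time is a return time, not described by the path sums, so this value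
    -- is excluded.
    filter_upwards [eventually_gt_atTop 0] with y hy
    rw [hmean ω y (by exact_mod_cast hy.ne')]
  · rw [hmean1]
    exact (measurable_stepTime.comp henv).aemeasurable
  · rwa [hMint]
  · rw [hMint, one_div_one_div, ENNReal.ofReal_toReal hMtop.ne]
  · have h := ae_tendsto_log_crossWeight hρint hl
    rw [← hlaw] at h
    filter_upwards [ae_of_ae_map henv.aemeasurable h, hV] with ω hω hVω
    rw [hlaw] at hω
    refine hω.congr' ?_
    filter_upwards [eventually_gt_atTop 0] with y hy
    rw [partitionFunction_eq _ (by exact_mod_cast hy.ne'), envWeight]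
    simp only [hVω]
  · rw [one_div_one_div]
    exact hasDerivWithinAt_integral_freeEnergy hρ hρint
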